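/- All graphs are finite, simple and undirected. A graph is chordal if it contains no induced cycle on at least four vertices. For two distinct nonadjacent vertices $x, y$ of a graph $F$, a mixed $x$–$y$ separator is a pair $(V_S, E_S)$ with $V_S \subseteq V(F)\setminus\{x,y\}$ and $E_S \subseteq E(F)$ such that, after the deletion of the vertices of $V_S$ and the edges of $E_S$, the vertices $x$ and $y$ lie in different connected components. Its size is at most $(a,b)$ if $|V_S| \le a$ and $|E_S| \le b$. Lemma. There is a deterministic algorithm that, given a chordal graph $F$, two distinct nonadjacent vertices $x, y$ of $F$ and nonnegative integers $a, b$, runs in time $3^{a+b+1}\cdot |V(F)|^{O(1)}$ and either outputs a mixed $x$–$y$ separator of $F$ of size at most $(a,b)$, or, if none exists, reports that none exists. (The algorithm and the constant hidden in $O(1)$ depend on none of $F, x, y, a, b$.) -/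

import Mathlib

open scoped Classical in
/-- The value `1` if `p` holds and `0` otherwise. -/
noncomputable def bit01 (p : Prop) : ℕ := if p then 1 else 0

/-! ## Graphs -/

namespace SimpleGraph

/-- A graph is chordal if it contains no hole, i.e. no induced cycle on at least four vertices. -/
def IsChordalGraph {V : Type*} (F : SimpleGraph V) : Prop :=
  ∀ k : ℕ, 4 ≤ k → IsEmpty (cycleGraph k ↪g F)

/-- `(VS, ES)` is a mixed `x`-`y` separator of `F`: a set of vertices and a set of edges of `F`
whose deletion leaves `x` and `y` (neither of which is deleted) in different components. -/
def IsMixedSeparator {V : Type*} (F : SimpleGraph V) (x y : V)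
    (VS : Finset V) (ES : Finset (Sym2 V)) : Prop :=
  (ES : Set (Sym2 V)) ⊆ F.edgeSet ∧
  ∃ (hx : x ∈ (VS : Set V)ᶜ) (hy : y ∈ (VS : Set V)ᶜ),
    ¬ ((F.deleteEdges (ES : Set (Sym2 V))).induce (VS : Set V)ᶜ).Reachable ⟨x, hx⟩ ⟨y, hy⟩

/-- A mixed `x`-`y` separator with at most `a` vertices and at most `b` edges. -/
def IsMixedSeparatorOfSizeAtMost {V : Type*} (F : SimpleGraph V) (x y : V) (a b : ℕ)
    (VS : Finset V) (ES : Finset (Sym2 V)) : Prop :=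
  F.IsMixedSeparator x y VS ES ∧ VS.card ≤ a ∧ ES.card ≤ b

end SimpleGraph

/-! ## The model of computation

A deterministic first-order language with recursive functions, whose data are natural numbers and
cons cells. Every evaluation step costs one unit. The only operation that produces a larger number
is the successor, so after `t` steps all numbers are at most `t` plus the largest number in the
program or the input; each step is therefore a constant number of operations of a random access
machine (a cons cell is a record holding two pointers or numbers). -/

namespace Lisp

/-- Data: natural numbers and cons cells. -/
inductive Val : Type
  | num (n : ℕ)
  | cons (u v : Val)

/-- Expressions. Variables are de Bruijn indices into the current environment. -/
inductive Expr : Type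
  | var (i : ℕ)
  | const (n : ℕ)
  | succ (e : Expr)
  | sub (e₁ e₂ : Expr)
  | eq (e₁ e₂ : Expr)
  | cons (e₁ e₂ : Expr)
  | fst (e : Expr)
  | snd (e : Expr)
  | ite (e₁ e₂ e₃ : Expr)
  | letE (e₁ e₂ : Expr)
  | call (f : ℕ) (e : Expr)

/-- A program: finitely many function bodies, which may call one another by their index in the
list, and a main expression. Each function has one argument, its variable `0`. -/
structure Program : Type where
  funs : List Expr
  main : Expr

/-- `Eval P env e v t`: in the environment `env`, the expression `e` evaluates (call by value) to
the value `v` in exactly `t` steps. In `ite`, the number `0` means false and every other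
value means true. -/
inductive Eval (P : Program) : List Val → Expr → Val → ℕ → Prop
  | var {env : List Val} {i : ℕ} {v : Val} (h : env[i]? = some v) :
      Eval P env (.var i) v 1
  | const {env : List Val} {n : ℕ} :
      Eval P env (.const n) (.num n) 1
  | succ {env : List Val} {e : Expr} {n t : ℕ} (h : Eval P env e (.num n) t) :
      Eval P env (.succ e) (.num (n + 1)) (t + 1)
  | sub {env : List Val} {e₁ e₂ : Expr} {m n t₁ t₂ : ℕ}
      (h₁ : Eval P env e₁ (.num m) t₁) (h₂ : Eval P env e₂ (.num n) t₂) :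
      Eval P env (.sub e₁ e₂) (.num (m - n)) (t₁ + t₂ + 1)
  | eq {env : List Val} {e₁ e₂ : Expr} {m n t₁ t₂ : ℕ}
      (h₁ : Eval P env e₁ (.num m) t₁) (h₂ : Eval P env e₂ (.num n) t₂) :
      Eval P env (.eq e₁ e₂) (.num (if m = n then 1 else 0)) (t₁ + t₂ + 1)
  | cons {env : List Val} {e₁ e₂ : Expr} {u v : Val} {t₁ t₂ : ℕ}
      (h₁ : Eval P env e₁ u t₁) (h₂ : Eval P env e₂ v t₂) :
      Eval P env (.cons e₁ e₂) (.cons u v) (t₁ + t₂ + 1)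
  | fst {env : List Val} {e : Expr} {u v : Val} {t : ℕ} (h : Eval P env e (.cons u v) t) :
      Eval P env (.fst e) u (t + 1)
  | snd {env : List Val} {e : Expr} {u v : Val} {t : ℕ} (h : Eval P env e (.cons u v) t) :
      Eval P env (.snd e) v (t + 1)
  | iteTrue {env : List Val} {e₁ e₂ e₃ : Expr} {u v : Val} {t₁ t₂ : ℕ}
      (h₁ : Eval P env e₁ u t₁) (hu : u ≠ .num 0) (h₂ : Eval P env e₂ v t₂) :
      Eval P env (.ite e₁ e₂ e₃) v (t₁ + t₂ + 1)
  | iteFalse {env : List Val} {e₁ e₂ e₃ : Expr} {v : Val} {t₁ t₃ : ℕ}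
      (h₁ : Eval P env e₁ (.num 0) t₁) (h₃ : Eval P env e₃ v t₃) :
      Eval P env (.ite e₁ e₂ e₃) v (t₁ + t₃ + 1)
  | letE {env : List Val} {e₁ e₂ : Expr} {u v : Val} {t₁ t₂ : ℕ}
      (h₁ : Eval P env e₁ u t₁) (h₂ : Eval P (u :: env) e₂ v t₂) :
      Eval P env (.letE e₁ e₂) v (t₁ + t₂ + 1)
  | call {env : List Val} {f : ℕ} {e body : Expr} {u v : Val} {t₁ t₂ : ℕ}
      (h₁ : Eval P env e u t₁) (hf : P.funs[f]? = some body) (h₂ : Eval P [u] body v t₂) :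
      Eval P env (.call f e) v (t₁ + t₂ + 1)

/-- On the input `u`, the program `P` halts with output `v` after exactly `t` steps. -/
def Program.Runs (P : Program) (u v : Val) (t : ℕ) : Prop :=
  Eval P [u] P.main v t

/-- A list as a chain of cons cells that ends in the number `0`. -/
def Val.ofList : List Val → Val
  | [] => .num 0
  | v :: l => .cons v (Val.ofList l)

/-- The adjacency matrix of a graph on `{0, …, n - 1}`, as a list of rows with entries `0`, `1`. -/
noncomputable def encodeGraph {n : ℕ} (F : SimpleGraph (Fin n)) : Val :=
  Val.ofList (List.ofFn fun i : Fin n =>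
    Val.ofList (List.ofFn fun j : Fin n => Val.num (bit01 (F.Adj i j))))

/-- The input `(F, x, y, a, b)`. -/
noncomputable def encodeInput {n : ℕ} (F : SimpleGraph (Fin n)) (x y : Fin n) (a b : ℕ) : Val :=
  .cons (encodeGraph F) (.cons (.num x) (.cons (.num y) (.cons (.num a) (.num b))))

/-- The value `v` is a pair of lists without repetition: one that lists the vertices in `VS` and
one that lists the edges in `ES`, each edge given as a pair of its endpoints. -/
def RepresentsPair {n : ℕ} (v : Val) (VS : Finset (Fin n)) (ES : Finset (Sym2 (Fin n))) : Prop :=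
  ∃ (l : List (Fin n)) (m : List (Fin n × Fin n)),
    l.Nodup ∧ l.toFinset = VS ∧
    (m.map fun p => s(p.1, p.2)).Nodup ∧ (m.map fun p => s(p.1, p.2)).toFinset = ES ∧
    v = .cons (Val.ofList (l.map fun u => Val.num u))
      (Val.ofList (m.map fun p => Val.cons (.num p.1) (.num p.2)))

/-- The answer "no such separator exists"; it is not a pair. -/
def answerNo : Val := .num 0

end Lisp

open Relation

/-! A mixed separator of minimum total size within the budgets is tight: each deleted edge runs
between the components of $x$ and $y$, and if no edge is deleted, each deleted vertex has neighbours
in both components. Hence these components contain vertices $u$ and $v$, respectively, that are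
either adjacent (the ends of a deleted edge) or both adjacent to every deleted vertex, with no edge
deleted. The second case uses chordality: a minimal vertex separator is a clique
(`IsChordalGraph.adj_of_joinedIn`), and each side contains a vertex complete to it
(`IsChordalGraph.exists_adj_clique`). The search tries all pairs $(u, v)$.

Put $u$ on side 1 and $v$ on side 2. An unassigned vertex that sees both sides is deleted by the
tight separator or lies in the component of $x$ or of $y$, which gives three branches. Deleting it
costs a vertex; putting it on one side cuts its edge to the other. So at most $a+b+1$ branchings are
nested before a budget is exceeded, whence the factor $3^{a+b+1}$.

Once no unassigned vertex sees both sides, the deletions already separate them. If $u$ and $v$ are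
adjacent, this is `IsChordalGraph.not_reflTransGen_labelStep`: a shortest connection through
unassigned vertices, closed up through the sides and the edge $uv$, would contradict chordality.
Otherwise every vertex of the tight separator sees both $u$ and $v$ and has therefore been deleted.
Side 1 then absorbs its unassigned neighbours without branching, and the answer can be read off.

Soundness needs only the final check of the labels (`isMixedSeparator_of_labels`). Completeness
enters the analysis of the program only through `IsSearchInvariant`. A concrete program is run in
the cost model; `search_computes` bounds its recursion by $3^m(f+1)$ times a quadratic local cost,
with $f$ bounding the unassigned vertices and $m$ the remaining branchings. -/

theorem reflTransGen_symm {V : Type*} {R : V → V → Prop} (hR : ∀ p q, R p q → R q p) {p q : V}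
    (h : ReflTransGen R p q) : ReflTransGen R q p := by
  induction h with
  | refl => exact .refl
  | tail _ hbc ih => exact .head (hR _ _ hbc) ih

theorem reflTransGen_lift {V W : Type*} {R : V → V → Prop} {S : W → W → Prop} (f : V → W)
    (hRS : ∀ p q, R p q → S (f p) (f q)) {p q : V} (h : ReflTransGen R p q) :
    ReflTransGen S (f p) (f q) := by
  induction h with
  | refl => exact .refl
  | tail _ hbc ih => exact ih.tail (hRS _ _ hbc)

theorem reflTransGen_mono {V : Type*} {R S : V → V → Prop} (hRS : ∀ p q, R p q → S p q) {p q : V}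
    (h : ReflTransGen R p q) : ReflTransGen S p q :=
  reflTransGen_lift id hRS h

/-- A shortest chain between two sets. -/
theorem exists_chordless_chain {V : Type*} {R : V → V → Prop} {P Q : V → Prop} {u v : V}
    (hP : P u) (hQ : Q v) (h : ReflTransGen R u v) :
    ∃ (d : ℕ) (f : ℕ → V), P (f 0) ∧ Q (f d) ∧ (∀ i < d, R (f i) (f (i + 1))) ∧
      (∀ i ≤ d, P (f i) → i = 0) ∧ (∀ i ≤ d, Q (f i) → i = d) ∧
      (∀ i j, i < j → j ≤ d → R (f i) (f j) → j = i + 1) ∧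
      (∀ i j, i < j → j ≤ d → f i ≠ f j) := by
  classical
  let C : ℕ → Prop := fun d => ∃ f : ℕ → V, P (f 0) ∧ Q (f d) ∧ ∀ i < d, R (f i) (f (i + 1))
  have hC : ∃ d, C d := by
    have key : ∀ w, ReflTransGen R u w →
        ∃ (d : ℕ) (f : ℕ → V), f 0 = u ∧ f d = w ∧ ∀ i < d, R (f i) (f (i + 1)) := by
      intro w hw
      induction hw with
      | refl => exact ⟨0, fun _ => u, rfl, rfl, by simp⟩
      | @tail b c _ hbc ih =>
        obtain ⟨d, f, h0, h1, h2⟩ := ih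
        refine ⟨d + 1, fun i => if i ≤ d then f i else c, by simp [h0], by simp, ?_⟩
        intro i hi
        rcases Nat.lt_succ_iff_lt_or_eq.mp hi with hlt | rfl
        · simp [hlt.le, Nat.succ_le_of_lt hlt, h2 i hlt]
        · simpa [h1] using hbc
    obtain ⟨d, f, h0, h1, h2⟩ := key v h
    exact ⟨d, f, by rwa [h0], by rwa [h1], h2⟩
  obtain ⟨f, h0, h1, h2⟩ := Nat.find_spec hC
  have hmin : ∀ d', C d' → Nat.find hC ≤ d' := fun d' h' => Nat.find_min' hC h'
  generalize Nat.find hC = d at *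
  -- Each of these properties holds because its failure would give a shorter chain from `P` to `Q`:
  -- cut off the end, bypass the positions strictly between `i` and `j`, or cut off the beginning.
  have hQ' : ∀ i ≤ d, Q (f i) → i = d := by
    intro i hi hq
    have := hmin i ⟨f, h0, hq, fun k hk => h2 k (by omega)⟩
    omega
  have hR' : ∀ i j, i < j → j ≤ d → R (f i) (f j) → j = i + 1 := by
    intro i j hij hj hr
    have := hmin (d - (j - i - 1)) ⟨fun k => if k ≤ i then f k else f (k + (j - i - 1)),
      by simpa using h0, by
        have hn : ¬ d - (j - i - 1) ≤ i := by omega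
        have he : d - (j - i - 1) + (j - i - 1) = d := by omega
        simpa only [hn, if_false, he] using h1, by
        intro k hk
        rcases lt_trichotomy k i with hlt | rfl | hgt
        · have h3 : k + 1 ≤ i := hlt
          simpa only [hlt.le, h3, if_true] using h2 k (by omega)
        · have h3 : ¬ k + 1 ≤ k := by omega
          have he : k + 1 + (j - k - 1) = j := by omega
          simpa only [le_refl, h3, if_true, if_false, he] using hr
        · have h3 : ¬ k + 1 ≤ i := by omega
          have h4 : ¬ k ≤ i := by omega
          have he : k + 1 + (j - i - 1) = k + (j - i - 1) + 1 := by omega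
          simpa only [h3, h4, if_false, he] using h2 (k + (j - i - 1)) (by omega)⟩
    omega
  refine ⟨d, f, h0, h1, h2, ?_, hQ', hR', ?_⟩
  · intro i hi hp
    have := hmin (d - i) ⟨fun k => f (k + i), by simpa using hp, by
      have he : d - i + i = d := by omega
      simpa only [he] using h1, fun k hk => by
      have he : k + 1 + i = k + i + 1 := by omega
      simpa only [he] using h2 (k + i) (by omega)⟩
    omega
  -- A repetition would create a chord to `f (j + 1)`, or put an early vertex into `Q` if `j = d`.
  · intro i j hij hj he
    rcases Nat.lt_or_ge j d with hlt | hge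
    · have := hR' i (j + 1) (by omega) hlt (he ▸ h2 j hlt)
      omega
    · obtain rfl : j = d := le_antisymm hj hge
      have := hQ' i hij.le (he ▸ h1)
      omega

namespace SimpleGraph

/-! ### Connected sets and cliques in chordal graphs -/

variable {V : Type*} {F : SimpleGraph V}

/-- `p` and `q` are joined by a walk of `F` inside the set `B`. -/
def JoinedIn (F : SimpleGraph V) (B : V → Prop) : V → V → Prop :=
  ReflTransGen fun p q => F.Adj p q ∧ B p ∧ B q

theorem JoinedIn.symm {B : V → Prop} {p q : V} (h : F.JoinedIn B p q) : F.JoinedIn B q p :=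
  reflTransGen_symm (fun _ _ h => ⟨h.1.symm, h.2.2, h.2.1⟩) h

theorem JoinedIn.mono {B C : V → Prop} (hBC : ∀ p, B p → C p) {p q : V}
    (h : F.JoinedIn B p q) : F.JoinedIn C p q :=
  reflTransGen_mono (fun _ _ h => ⟨h.1, hBC _ h.2.1, hBC _ h.2.2⟩) h

theorem JoinedIn.of_chain {B : V → Prop} {f : ℕ → V} {i j : ℕ} (hij : i ≤ j)
    (hB : ∀ k, i ≤ k → k ≤ j → B (f k)) (hf : ∀ k, i ≤ k → k < j → F.Adj (f k) (f (k + 1))) :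
    F.JoinedIn B (f i) (f j) := by
  induction j, hij using Nat.le_induction with
  | base => exact .refl
  | succ j hij ih =>
    exact (ih (fun k h1 _ => hB k h1 (by omega)) (fun k h1 h2 => hf k h1 (by omega))).tail
      ⟨hf j hij (by omega), hB _ hij (by omega), hB _ (by omega) le_rfl⟩

theorem cycleGraph_adj_of_lt {k : ℕ} {i j : Fin k} (hij : i < j) :
    (cycleGraph k).Adj i j ↔ j.val = i.val + 1 ∨ (i.val = 0 ∧ j.val + 1 = k) := by
  have hi := i.2
  have hj := j.2
  have h : i.val < j.val := hij
  rw [cycleGraph_adj', Fin.coe_sub_iff_lt.mpr hij, Fin.coe_sub_iff_le.mpr hij.le]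
  omega

/-- In a chordal graph, an edge whose two ends have neighbours in the same connected set forms a
triangle with a vertex of that set. -/
theorem IsChordalGraph.exists_common_adj (hF : F.IsChordalGraph) {B : V → Prop} {s t b c : V}
    (hst : F.Adj s t) (hs : ¬ B s) (ht : ¬ B t) (hb : B b) (hc : B c) (hsb : F.Adj s b)
    (htc : F.Adj t c) (hbc : F.JoinedIn B b c) : ∃ z, B z ∧ F.Adj s z ∧ F.Adj t z := by
  obtain ⟨d, f, h0, hd, hR, hP, hQ, hch, hinj⟩ := exists_chordless_chain
    (P := fun p => B p ∧ F.Adj s p) (Q := fun p => B p ∧ F.Adj t p) ⟨hb, hsb⟩ ⟨hc, htc⟩ hbc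
  have hfB : ∀ i ≤ d, B (f i) := by
    intro i hi
    rcases Nat.lt_or_ge i d with h | h
    · exact (hR i h).2.1
    · exact le_antisymm hi h ▸ hd.1
  rcases Nat.eq_zero_or_pos d with rfl | hpos
  · exact ⟨f 0, h0.1, h0.2, hd.2⟩
  exfalso
  -- The shortest path `f 0, …, f d` followed by `t` and `s` is an induced cycle, of length `d + 3 ≥
  -- 4` because `d > 0`.
  let g : Fin (d + 3) → V := fun i => if i.val ≤ d then f i else if i.val = d + 1 then t else s
  have key : ∀ i j : Fin (d + 3), i < j → g i ≠ g j ∧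
      (F.Adj (g i) (g j) ↔ (cycleGraph (d + 3)).Adj i j) := by
    intro i j hij
    rw [cycleGraph_adj_of_lt hij]
    have h : i.val < j.val := hij
    have hj := j.2
    rcases Nat.lt_or_ge d j.val with hdj | hdj
    · rcases Nat.lt_or_ge (d + 1) j.val with hdj' | hdj'
      · have ej : g j = s := by simp [g, show ¬ j.val ≤ d by omega, show j.val ≠ d + 1 by omega]
        rcases Nat.lt_or_ge d i.val with hdi | hdi
        · have ei : g i = t := by simp [g, show i.val = d + 1 by omega]
          rw [ei, ej]
          exact ⟨hst.ne', by simp only [hst.symm, true_iff]; omega⟩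
        · have ei : g i = f i := by simp [g, hdi]
          rw [ei, ej]
          refine ⟨fun h => hs (h ▸ hfB i hdi), ?_⟩
          constructor
          · intro ha
            have := hP i hdi ⟨hfB i hdi, ha.symm⟩
            omega
          · intro h'
            rw [show i.val = 0 by omega]
            exact h0.2.symm
      · have ej : g j = t := by simp [g, show j.val = d + 1 by omega]
        have ei : g i = f i := by simp [g, show i.val ≤ d by omega]
        rw [ei, ej]
        refine ⟨fun h => ht (h ▸ hfB i (by omega)), ?_⟩
        constructor
        · intro ha
          have := hQ i (by omega) ⟨hfB i (by omega), ha.symm⟩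
          omega
        · intro h'
          rw [show i.val = d by omega]
          exact hd.2.symm
    · have ej : g j = f j := by simp [g, hdj]
      have ei : g i = f i := by simp [g, show i.val ≤ d by omega]
      rw [ei, ej]
      refine ⟨hinj i j h hdj, ?_⟩
      constructor
      · intro ha
        exact Or.inl (hch i j h hdj ⟨ha, hfB i (by omega), hfB j hdj⟩)
      · intro h'
        rw [show j.val = i.val + 1 by omega]
        exact (hR i (by omega)).1
  refine (hF (d + 3) (by omega)).false ⟨⟨g, ?_⟩, ?_⟩
  · intro i j hij
    by_contra hne
    rcases lt_or_gt_of_ne hne with h | h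
    · exact (key i j h).1 hij
    · exact (key j i h).1 hij.symm
  · intro i j
    rcases lt_trichotomy i j with h | rfl | h
    · exact (key i j h).2
    · simp
    · rw [adj_comm, adj_comm (cycleGraph (d + 3))]
      exact (key j i h).2

/-- Two vertices that have neighbours in two connected sets without edges between them are
adjacent in a chordal graph. -/
theorem IsChordalGraph.adj_of_joinedIn (hF : F.IsChordalGraph) {A B : V → Prop}
    (hA : ∀ p q, A p → A q → F.JoinedIn A p q) (hB : ∀ p q, B p → B q → F.JoinedIn B p q)
    (hAB : ∀ p q, A p → B q → p ≠ q ∧ ¬ F.Adj p q) {s t a a' b b' : V} (hst : s ≠ t)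
    (hsA : ¬ A s) (htA : ¬ A t) (hsB : ¬ B s)
    (ha : A a) (hsa : F.Adj s a) (ha' : A a') (hta : F.Adj t a')
    (hb : B b) (hsb : F.Adj s b) (hb' : B b') (htb : F.Adj t b') : F.Adj s t := by
  by_contra hn
  obtain ⟨d, f, h0, hd, hR, hP, hQ, hch, hinj⟩ := exists_chordless_chain
    (P := fun p => A p ∧ F.Adj s p) (Q := fun p => A p ∧ F.Adj t p) ⟨ha, hsa⟩ ⟨ha', hta⟩
    (hA a a' ha ha')
  have hfA : ∀ i ≤ d, A (f i) := by
    intro i hi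
    rcases Nat.lt_or_ge i d with h | h
    · exact (hR i h).2.1
    · exact le_antisymm hi h ▸ hd.1
  -- The triangle lemma is applied to the edge from `s` to `f 0` and to the rest of the closed walk
  -- through `B`, `t` and the path. No vertex of `C` can be the apex: `B` has no edge to `A`, `t` is
  -- not adjacent to `s`, and `f 0` is the only neighbour of `s` on the path.
  let C : V → Prop := fun p => B p ∨ p = t ∨ ∃ i, 1 ≤ i ∧ i ≤ d ∧ p = f i
  have hsC : ¬ C s := by
    rintro (h | h | ⟨i, -, hi, h⟩)
    · exact hsB h
    · exact hst h
    · exact hsA (h ▸ hfA i hi)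
  have h0C : ¬ C (f 0) := by
    rintro (h | h | ⟨i, h1, hi, h⟩)
    · exact (hAB _ _ (hfA 0 (Nat.zero_le _)) h).1 rfl
    · exact htA (h ▸ hfA 0 (Nat.zero_le _))
    · exact hinj 0 i h1 hi h
  have hbt : F.JoinedIn C b t :=
    ((hB b b' hb hb').mono fun p hp => Or.inl hp).tail ⟨htb.symm, Or.inl hb', Or.inr (Or.inl rfl)⟩
  have hex : ∃ c, C c ∧ F.Adj (f 0) c ∧ F.JoinedIn C b c := by
    rcases Nat.eq_zero_or_pos d with rfl | hpos
    · exact ⟨t, Or.inr (Or.inl rfl), hd.2.symm, hbt⟩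
    · have hfC : ∀ k, 1 ≤ k → k ≤ d → C (f k) := fun k h1 h2 => Or.inr (Or.inr ⟨k, h1, h2, rfl⟩)
      refine ⟨f 1, hfC 1 le_rfl hpos, (hR 0 hpos).1, ?_⟩
      refine (hbt.tail ⟨hd.2, Or.inr (Or.inl rfl), hfC d hpos le_rfl⟩).trans ?_
      exact JoinedIn.symm (JoinedIn.of_chain hpos hfC fun k h1 h2 => (hR k h2).1)
  obtain ⟨c, hc, h0c, hbc⟩ := hex
  obtain ⟨z, hz, hsz, h0z⟩ := hF.exists_common_adj h0.2 hsC h0C (Or.inl hb) hc hsb h0c hbc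
  rcases hz with h | h | ⟨i, h1, hi, rfl⟩
  · exact (hAB _ _ (hfA 0 (Nat.zero_le _)) h).2 h0z
  · exact hn (h ▸ hsz)
  · have := hP i hi ⟨hfA i hi, hsz⟩
    omega

/-- In a chordal graph, a connected set in which every vertex of a clique has a neighbour contains
a vertex that is adjacent to the whole clique. -/
theorem IsChordalGraph.exists_adj_clique (hF : F.IsChordalGraph) {A : V → Prop} (S : Finset V)
    (hA : ∀ p q, A p → A q → F.JoinedIn A p q) (hne : ∃ p, A p)
    (hS : ∀ s ∈ S, ∀ t ∈ S, s ≠ t → F.Adj s t) (hSA : ∀ s ∈ S, ¬ A s)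
    (hadj : ∀ s ∈ S, ∃ p, A p ∧ F.Adj s p) : ∃ p, A p ∧ ∀ s ∈ S, F.Adj s p := by
  classical
  induction S using Finset.induction_on with
  | empty => exact hne.imp fun p hp => ⟨hp, by simp⟩
  | insert s S hs ih =>
    obtain ⟨w, hw, hwS⟩ := ih (fun a ha b hb => hS a (by simp [ha]) b (by simp [hb]))
      (fun a ha => hSA a (by simp [ha])) (fun a ha => hadj a (by simp [ha]))
    obtain ⟨q, hq, hsq⟩ := hadj s (by simp)
    have hsA := hSA s (by simp)
    -- The new vertex is the end of a shortest path in `A` from `w` to the neighbours of `s`;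
    -- adjacency to each old `t` is carried along this path.
    obtain ⟨d, f, h0, hd, hR, hP, hQ, hch, hinj⟩ := exists_chordless_chain
      (P := fun p => p = w) (Q := fun p => A p ∧ F.Adj s p) rfl ⟨hq, hsq⟩ (hA w q hw hq)
    have hfA : ∀ i ≤ d, A (f i) := by
      intro i hi
      rcases Nat.lt_or_ge i d with h | h
      · exact (hR i h).2.1
      · exact le_antisymm hi h ▸ hd.1
    refine ⟨f d, hd.1, fun t ht => ?_⟩
    rcases Finset.mem_insert.mp ht with rfl | ht'
    · exact hd.2
    have hts : F.Adj t s := hS t ht s (by simp) (fun h => hs (h ▸ ht'))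
    have htA : ¬ A t := hSA t ht
    have step : ∀ i ≤ d, F.Adj t (f i) := by
      intro i
      induction i with
      | zero => intro _; rw [h0]; exact hwS t ht'
      | succ i ihi =>
        intro hi
        have hti := ihi (by omega)
        -- The triangle on the edge from `t` to `f i` has its apex in `C`. The apex is not `s`,
        -- since only `f d` sees `s`, so chordlessness forces it to be `f (i + 1)`.
        let C : V → Prop := fun p => p = s ∨ ∃ k, i + 1 ≤ k ∧ k ≤ d ∧ p = f k
        have hfC : ∀ k, i + 1 ≤ k → k ≤ d → C (f k) := fun k h1 h2 => Or.inr ⟨k, h1, h2, rfl⟩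
        have htC : ¬ C t := by
          rintro (h | ⟨k, -, hk, h⟩)
          · exact hts.ne h
          · exact htA (h ▸ hfA k hk)
        have hiC : ¬ C (f i) := by
          rintro (h | ⟨k, h1, hk, h⟩)
          · exact hsA (h ▸ hfA i (by omega))
          · exact hinj i k h1 hk h
        have hjoin : F.JoinedIn C s (f (i + 1)) :=
          JoinedIn.symm ((JoinedIn.of_chain hi hfC fun k h1 h2 => (hR k h2).1).tail
            ⟨hd.2.symm, hfC d hi le_rfl, Or.inl rfl⟩)
        obtain ⟨z, hz, htz, hiz⟩ := hF.exists_common_adj hti htC hiC (Or.inl rfl)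
          (hfC _ le_rfl hi) hts (hR i (by omega)).1 hjoin
        rcases hz with rfl | ⟨k, h1, hk, rfl⟩
        · have := hQ i (by omega) ⟨hfA i (by omega), hiz.symm⟩
          omega
        · have := hch i k h1 hk ⟨hiz, hfA i (by omega), hfA k hk⟩
          rwa [← this]
    exact step d le_rfl

/-! ### Mixed separators and tightness -/

/-- Adjacency after the deletion of the vertices in `VS` and the edges in `ES`. -/
def StepAvoiding (F : SimpleGraph V) (VS : Finset V) (ES : Finset (Sym2 V)) (p q : V) : Prop :=
  F.Adj p q ∧ p ∉ VS ∧ q ∉ VS ∧ s(p, q) ∉ ES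

/-- Joined by a walk that avoids the vertices in `VS` and the edges in `ES`. -/
def JoinedAvoiding (F : SimpleGraph V) (VS : Finset V) (ES : Finset (Sym2 V)) : V → V → Prop :=
  ReflTransGen (F.StepAvoiding VS ES)

theorem StepAvoiding.symm {VS : Finset V} {ES : Finset (Sym2 V)} {p q : V}
    (h : F.StepAvoiding VS ES p q) : F.StepAvoiding VS ES q p :=
  ⟨h.1.symm, h.2.2.1, h.2.1, Sym2.eq_swap (a := p) ▸ h.2.2.2⟩

theorem JoinedAvoiding.symm {VS : Finset V} {ES : Finset (Sym2 V)} {p q : V}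
    (h : F.JoinedAvoiding VS ES p q) : F.JoinedAvoiding VS ES q p :=
  reflTransGen_symm (fun _ _ h => h.symm) h

theorem JoinedAvoiding.notMem {VS : Finset V} {ES : Finset (Sym2 V)} {p q : V} (hp : p ∉ VS)
    (h : F.JoinedAvoiding VS ES p q) : q ∉ VS := by
  cases h with
  | refl => exact hp
  | tail _ h => exact h.2.2.1

/-- This moves reachability from a subtype to a relation on `V`. The conditions `x ∉ VS` and `y ∉
VS` stay separate because `JoinedAvoiding` is reflexive even at deleted vertices. -/
theorem isMixedSeparator_iff {x y : V} {VS : Finset V} {ES : Finset (Sym2 V)} :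
    F.IsMixedSeparator x y VS ES ↔ (ES : Set (Sym2 V)) ⊆ F.edgeSet ∧ x ∉ VS ∧ y ∉ VS ∧
      ¬ F.JoinedAvoiding VS ES x y := by
  have key : ∀ (hx : x ∈ (VS : Set V)ᶜ) (hy : y ∈ (VS : Set V)ᶜ),
      ((F.deleteEdges (ES : Set (Sym2 V))).induce (VS : Set V)ᶜ).Reachable ⟨x, hx⟩ ⟨y, hy⟩ ↔
        F.JoinedAvoiding VS ES x y := by
    intro hx hy
    rw [reachable_iff_reflTransGen]
    constructor
    · intro h
      refine reflTransGen_lift (fun p : ↥((VS : Set V)ᶜ) => p.1) (fun p q hpq => ?_) h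
      simp only [induce_adj, deleteEdges_adj] at hpq
      exact ⟨hpq.1, fun h => p.2 h, fun h => q.2 h, by simpa using hpq.2⟩
    · intro h
      have gen : ∀ z, F.JoinedAvoiding VS ES x z → ∃ hz : z ∈ (VS : Set V)ᶜ,
          ReflTransGen ((F.deleteEdges (ES : Set (Sym2 V))).induce (VS : Set V)ᶜ).Adj
            ⟨x, hx⟩ ⟨z, hz⟩ := by
        intro z hz
        induction hz with
        | refl => exact ⟨hx, .refl⟩
        | @tail b c _ hbc ih =>
          obtain ⟨hb, ih⟩ := ih
          refine ⟨by simpa using hbc.2.2.1, ih.tail ?_⟩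
          simp only [induce_adj, deleteEdges_adj]
          exact ⟨hbc.1, by simpa using hbc.2.2.2⟩
      exact (gen y h).2
  constructor
  · rintro ⟨hE, hx, hy, h⟩
    exact ⟨hE, by simpa using hx, by simpa using hy, fun h' => h ((key hx hy).mpr h')⟩
  · rintro ⟨hE, hx, hy, h⟩
    have hx' : x ∈ (VS : Set V)ᶜ := by simpa using hx
    have hy' : y ∈ (VS : Set V)ᶜ := by simpa using hy
    exact ⟨hE, hx', hy', fun h' => h ((key hx' hy').mp h')⟩

/-- If restoring the edge `pq` joins `x` and `y`, then `pq` runs between their components. -/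
theorem JoinedAvoiding.of_erase_edge [DecidableEq V] {VS : Finset V} {ES : Finset (Sym2 V)}
    {x y p q : V} (h : F.JoinedAvoiding VS (ES.erase s(p, q)) x y) :
    F.JoinedAvoiding VS ES x y ∨
      (F.JoinedAvoiding VS ES x p ∧ F.JoinedAvoiding VS ES q y) ∨
      (F.JoinedAvoiding VS ES x q ∧ F.JoinedAvoiding VS ES p y) := by
  induction h with
  | refl => exact Or.inl .refl
  | @tail b c _ hbc ih =>
    by_cases hS : F.StepAvoiding VS ES b c
    · exact ih.imp (fun h => h.tail hS)
        (Or.imp (fun h => ⟨h.1, h.2.tail hS⟩) (fun h => ⟨h.1, h.2.tail hS⟩))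
    · have he : s(b, c) = s(p, q) := by
        by_contra hne
        exact hS ⟨hbc.1, hbc.2.1, hbc.2.2.1, fun h => hbc.2.2.2 (Finset.mem_erase.mpr ⟨hne, h⟩)⟩
      rcases Sym2.eq_iff.mp he with ⟨rfl, rfl⟩ | ⟨rfl, rfl⟩
      · rcases ih with h | h | h
        · exact Or.inr (Or.inl ⟨h, .refl⟩)
        · exact Or.inr (Or.inl ⟨h.1, .refl⟩)
        · exact Or.inl h.1
      · rcases ih with h | h | h
        · exact Or.inr (Or.inr ⟨h, .refl⟩)
        · exact Or.inl h.1
        · exact Or.inr (Or.inr ⟨h.1, .refl⟩)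

/-- If restoring the vertex `s` joins `x` and `y`, then `s` has neighbours in their components. -/
theorem JoinedAvoiding.of_erase_vertex [DecidableEq V] {VS : Finset V} {x y s : V} (hx : x ∉ VS)
    (h : F.JoinedAvoiding (VS.erase s) ∅ x y) :
    F.JoinedAvoiding VS ∅ x y ∨ ((∃ t, F.Adj s t ∧ F.JoinedAvoiding VS ∅ x t) ∧
      (y = s ∨ ∃ t, F.Adj s t ∧ F.JoinedAvoiding VS ∅ t y)) := by
  induction h with
  | refl => exact Or.inl .refl
  | @tail b c _ hbc ih =>
    by_cases hc : c = s
    · subst hc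
      rcases ih with h | ⟨h, -⟩
      · exact Or.inr ⟨⟨b, hbc.1.symm, h⟩, Or.inl rfl⟩
      · exact Or.inr ⟨h, Or.inl rfl⟩
    have hc' : c ∉ VS := fun h => hbc.2.2.1 (Finset.mem_erase.mpr ⟨hc, h⟩)
    by_cases hb : b = s
    · subst hb
      rcases ih with h | ⟨h, -⟩
      · exact Or.inl (h.tail ⟨hbc.1, h.notMem hx, hc', by simp⟩)
      · exact Or.inr ⟨h, Or.inr ⟨c, hbc.1, .refl⟩⟩
    have hS : F.StepAvoiding VS ∅ b c :=
      ⟨hbc.1, fun h => hbc.2.1 (Finset.mem_erase.mpr ⟨hb, h⟩), hc', by simp⟩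
    rcases ih with h | ⟨h, h' | ⟨t, ht, htb⟩⟩
    · exact Or.inl (h.tail hS)
    · exact absurd h' hb
    · exact Or.inr ⟨h, Or.inr ⟨t, ht, htb.tail hS⟩⟩

/-- A mixed separator of which no proper part is one. -/
structure IsTightSeparator (F : SimpleGraph V) (x y : V) (VS : Finset V) (ES : Finset (Sym2 V)) :
    Prop where
  left : x ∉ VS
  right : y ∉ VS
  sep : ¬ F.JoinedAvoiding VS ES x y
  edge_mem : ∀ e ∈ ES, e ∈ F.edgeSet
  edge : ∀ p q, s(p, q) ∈ ES →
    (F.JoinedAvoiding VS ES x p ∧ F.JoinedAvoiding VS ES y q) ∨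
      (F.JoinedAvoiding VS ES x q ∧ F.JoinedAvoiding VS ES y p)
  vertex : ES = ∅ → ∀ s ∈ VS, (∃ t, F.Adj s t ∧ F.JoinedAvoiding VS ES x t) ∧
    ∃ t, F.Adj s t ∧ F.JoinedAvoiding VS ES y t

/-- Take a separator of minimum total size within the budgets. Restoring one of its edges, or one of
its vertices when no edge is deleted, must reconnect `x` and `y`, which locates that edge or vertex
between the two components. -/
theorem IsMixedSeparatorOfSizeAtMost.exists_tight {x y : V} {a b : ℕ}
    (h : ∃ VS ES, F.IsMixedSeparatorOfSizeAtMost x y a b VS ES) :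
    ∃ VS ES, F.IsTightSeparator x y VS ES ∧ VS.card ≤ a ∧ ES.card ≤ b := by
  classical
  have hex : ∃ k VS ES, F.IsMixedSeparatorOfSizeAtMost x y a b VS ES ∧ VS.card + ES.card = k := by
    obtain ⟨VS, ES, h⟩ := h
    exact ⟨_, VS, ES, h, rfl⟩
  obtain ⟨VS, ES, ⟨hsep, ha, hb⟩, hk⟩ := Nat.find_spec hex
  have hmin : ∀ VS' ES', F.IsMixedSeparator x y VS' ES' → VS'.card ≤ VS.card →
      ES'.card ≤ ES.card → VS.card + ES.card ≤ VS'.card + ES'.card := fun VS' ES' h1 h2 h3 =>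
    hk ▸ Nat.find_min' hex ⟨VS', ES', ⟨h1, h2.trans ha, h3.trans hb⟩, rfl⟩
  obtain ⟨hE, hx, hy, hn⟩ := isMixedSeparator_iff.mp hsep
  refine ⟨VS, ES, ⟨hx, hy, hn, fun e he => hE he, ?_, ?_⟩, ha, hb⟩
  · intro p q hpq
    have hc := Finset.card_erase_lt_of_mem hpq
    have hj : F.JoinedAvoiding VS (ES.erase s(p, q)) x y := by
      by_contra hj
      have := hmin VS (ES.erase s(p, q)) (isMixedSeparator_iff.mpr
        ⟨fun e he => hE (Finset.mem_of_mem_erase he), hx, hy, hj⟩) le_rfl hc.le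
      omega
    rcases hj.of_erase_edge with h | h | h
    · exact absurd h hn
    · exact Or.inl ⟨h.1, h.2.symm⟩
    · exact Or.inr ⟨h.1, h.2.symm⟩
  · rintro rfl s hs
    have hc := Finset.card_erase_lt_of_mem hs
    have hj : F.JoinedAvoiding (VS.erase s) ∅ x y := by
      by_contra hj
      have := hmin (VS.erase s) ∅ (isMixedSeparator_iff.mpr
        ⟨hE, fun h => hx (Finset.mem_of_mem_erase h), fun h => hy (Finset.mem_of_mem_erase h), hj⟩)
        hc.le le_rfl
      omega
    rcases hj.of_erase_vertex hx with h | ⟨h, rfl | ⟨t, ht, hty⟩⟩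
    · exact absurd h hn
    · exact absurd hs hy
    · exact ⟨h, t, ht, hty.symm⟩

theorem JoinedAvoiding.joinedIn {VS : Finset V} {ES : Finset (Sym2 V)} {x p q : V}
    (hp : F.JoinedAvoiding VS ES x p) (hq : F.JoinedAvoiding VS ES x q) :
    F.JoinedIn (F.JoinedAvoiding VS ES x) p q := by
  have key : ∀ p, F.JoinedAvoiding VS ES x p → F.JoinedIn (F.JoinedAvoiding VS ES x) x p := by
    intro p hp
    induction hp with
    | refl => exact .refl
    | tail h hbc ih => exact ih.tail ⟨hbc.1, h, h.tail hbc⟩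
  exact (key p hp).symm.trans (key q hq)

/-- In a chordal graph, a minimal vertex separator lies in a common neighbourhood of two vertices
on its two sides. -/
theorem IsTightSeparator.exists_adj (hF : F.IsChordalGraph) {x y : V} {VS : Finset V}
    (h : F.IsTightSeparator x y VS ∅) :
    ∃ u v, F.JoinedAvoiding VS ∅ x u ∧ F.JoinedAvoiding VS ∅ y v ∧
      ∀ s ∈ VS, F.Adj s u ∧ F.Adj s v := by
  have hA : ∀ s ∈ VS, ¬ F.JoinedAvoiding VS ∅ x s := fun s hs hj => hj.notMem h.left hs
  have hB : ∀ s ∈ VS, ¬ F.JoinedAvoiding VS ∅ y s := fun s hs hj => hj.notMem h.right hs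
  have hAB : ∀ p q, F.JoinedAvoiding VS ∅ x p → F.JoinedAvoiding VS ∅ y q →
      p ≠ q ∧ ¬ F.Adj p q := by
    intro p q hp hq
    constructor
    · rintro rfl
      exact h.sep (hp.trans hq.symm)
    · intro hpq
      exact h.sep ((hp.tail ⟨hpq, hp.notMem h.left, hq.notMem h.right, by simp⟩).trans hq.symm)
  -- The components of `x` and `y` are the two connected sets without edges between them, as no edge
  -- is deleted.
  have hclique : ∀ s ∈ VS, ∀ t ∈ VS, s ≠ t → F.Adj s t := by
    intro s hs t ht hst
    obtain ⟨⟨p, hsp, hp⟩, q, hsq, hq⟩ := h.vertex rfl s hs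
    obtain ⟨⟨p', htp, hp'⟩, q', htq, hq'⟩ := h.vertex rfl t ht
    exact hF.adj_of_joinedIn (fun _ _ => JoinedAvoiding.joinedIn)
      (fun _ _ => JoinedAvoiding.joinedIn) hAB hst (hA s hs) (hA t ht) (hB s hs)
      hp hsp hp' htp hq hsq hq' htq
  obtain ⟨u, hu, huS⟩ := hF.exists_adj_clique VS (A := F.JoinedAvoiding VS ∅ x)
    (fun _ _ => JoinedAvoiding.joinedIn) ⟨x, .refl⟩ hclique hA
    (fun s hs => ((h.vertex rfl s hs).1).imp fun p hp => ⟨hp.2, hp.1⟩)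
  obtain ⟨v, hv, hvS⟩ := hF.exists_adj_clique VS (A := F.JoinedAvoiding VS ∅ y)
    (fun _ _ => JoinedAvoiding.joinedIn) ⟨y, .refl⟩ hclique hB
    (fun s hs => ((h.vertex rfl s hs).2).imp fun p hp => ⟨hp.2, hp.1⟩)
  exact ⟨u, v, hu, hv, fun s hs => ⟨huS s hs, hvS s hs⟩⟩

/-! ### Labelings

A labeling marks vertices as unassigned (`0`), on the side of `x` (`1`), on the side of `y` (`2`),
or deleted (`3`). -/

/-- An unassigned vertex with neighbours labelled `1` and `c`. -/
def IsContact (F : SimpleGraph V) (lam : V → ℕ) (c : ℕ) (w : V) : Prop :=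
  lam w = 0 ∧ (∃ p, F.Adj w p ∧ lam p = 1) ∧ ∃ q, F.Adj w q ∧ lam q = c

/-- Adjacency after the deletion of the vertices labelled `3` and of the edges between the
labels `1` and `2`. -/
def LabelStep (F : SimpleGraph V) (lam : V → ℕ) (p q : V) : Prop :=
  F.Adj p q ∧ lam p ≠ 3 ∧ lam q ≠ 3 ∧ ¬ (lam p = 1 ∧ lam q = 2) ∧ ¬ (lam p = 2 ∧ lam q = 1)

theorem LabelStep.symm {lam : V → ℕ} {p q : V} (h : F.LabelStep lam p q) : F.LabelStep lam q p :=
  ⟨h.1.symm, h.2.2.1, h.2.1, fun h' => h.2.2.2.2 ⟨h'.2, h'.1⟩, fun h' => h.2.2.2.1 ⟨h'.2, h'.1⟩⟩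

/-- A labeling that is compatible with a tight separator and whose two sides are connected. -/
def IsGrowing (F : SimpleGraph V) (x y : V) (VS : Finset V) (ES : Finset (Sym2 V))
    (lam : V → ℕ) : Prop :=
  ∃ u v, lam u = 1 ∧ lam v = 2 ∧ (∀ p, lam p ≤ 3) ∧ (∀ p, lam p = 3 → p ∈ VS) ∧
    (∀ p, lam p = 1 → F.JoinedAvoiding VS ES x p ∧ F.JoinedIn (fun z => lam z = 1) p u) ∧
    (∀ p, lam p = 2 → F.JoinedAvoiding VS ES y p ∧ F.JoinedIn (fun z => lam z = 2) p v) ∧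
    (F.Adj u v ∨ ES = ∅ ∧ ∀ s ∈ VS, F.Adj s u ∧ F.Adj s v)

/-- A labeling whose deletions separate `x` and `y` and are part of `VS` and `ES`. -/
def IsSeparating (F : SimpleGraph V) (x y : V) (VS : Finset V) (ES : Finset (Sym2 V))
    (lam : V → ℕ) : Prop :=
  (∀ p, lam p = 3 → p ∈ VS) ∧
    (∀ p q, F.Adj p q → lam p = 1 → lam q = 2 → s(p, q) ∈ ES) ∧
    (∃ u, lam u = 1 ∧ ReflTransGen (F.LabelStep lam) x u) ∧
    (∃ v, lam v = 2 ∧ ReflTransGen (F.LabelStep lam) y v) ∧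
    ∀ p q, lam p = 1 → lam q = 2 → ¬ ReflTransGen (F.LabelStep lam) p q

/-- In a chordal graph, two connected sides with an edge between them are separated by the deleted
vertices and the edges between them, unless some unassigned vertex sees both. -/
theorem IsChordalGraph.not_reflTransGen_labelStep (hF : F.IsChordalGraph) {lam : V → ℕ} {u v : V}
    (hle : ∀ p, lam p ≤ 3) (hu : lam u = 1) (hv : lam v = 2) (huv : F.Adj u v)
    (h1 : ∀ p, lam p = 1 → F.JoinedIn (fun z => lam z = 1) p u)
    (h2 : ∀ p, lam p = 2 → F.JoinedIn (fun z => lam z = 2) p v)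
    (hc : ∀ w, ¬ F.IsContact lam 2 w) {p q : V} (hp : lam p = 1) (hq : lam q = 2) :
    ¬ ReflTransGen (F.LabelStep lam) p q := by
  intro hpq
  let R : V → V → Prop := fun p q => F.Adj p q ∧ lam p = 0 ∧ lam q = 0
  let P : V → Prop := fun p => lam p = 0 ∧ ∃ z, F.Adj p z ∧ lam z = 1
  let Q : V → Prop := fun p => lam p = 0 ∧ ∃ z, F.Adj p z ∧ lam z = 2
  -- A walk that leaves label `1` cannot step directly to label `2`, so before reaching label `2` it
  -- must run through unassigned vertices, from one that sees label `1` to one that sees label `2`.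
  have hex : ∃ p0 q0, P p0 ∧ Q q0 ∧ ReflTransGen R p0 q0 := by
    by_contra hno
    have closed : ∀ z, ReflTransGen (F.LabelStep lam) p z →
        lam z = 1 ∨ (lam z = 0 ∧ ∃ p0, P p0 ∧ ReflTransGen R p0 z) := by
      intro z hz
      induction hz with
      | refl => exact Or.inl hp
      | @tail b c _ hbc ih =>
        obtain ⟨hadj, hb3, hc3, hn1, -⟩ := hbc
        have hlc := hle c
        rcases ih with hb | ⟨hb, p0, hp0, hR⟩
        · rcases (show lam c = 0 ∨ lam c = 1 ∨ lam c = 2 by omega) with h | h | h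
          · exact Or.inr ⟨h, c, ⟨h, b, hadj.symm, hb⟩, .refl⟩
          · exact Or.inl h
          · exact absurd ⟨hb, h⟩ hn1
        · rcases (show lam c = 0 ∨ lam c = 1 ∨ lam c = 2 by omega) with h | h | h
          · exact Or.inr ⟨h, p0, hp0, hR.tail ⟨hadj, hb, h⟩⟩
          · exact Or.inl h
          · exact absurd ⟨p0, b, hp0, ⟨hb, c, hadj, h⟩, hR⟩ hno
    rcases closed q hpq with h | h <;> omega
  obtain ⟨p0, q0, hp0, hq0, hR0⟩ := hex
  obtain ⟨d, f, h0, hd, hR, hP, hQ, hch, hinj⟩ := exists_chordless_chain hp0 hq0 hR0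
  have hf0 : ∀ i ≤ d, lam (f i) = 0 := by
    intro i hi
    rcases Nat.lt_or_ge i d with h | h
    · exact (hR i h).2.1
    · exact le_antisymm hi h ▸ hd.1
  rcases Nat.eq_zero_or_pos d with rfl | hpos
  · exact hc _ ⟨h0.1, h0.2, hd.2⟩
  -- Both sides, linked by the edge `uv`, and the rest of the path form a connected set seen by `f
  -- 0` and `f 1`. A common neighbour in it contradicts the minimality of the path: with label `1`
  -- it lets the path start at `f 1`, with label `2` it lets it end at `f 0`, and on the path it
  -- gives a chord.
  let B : V → Prop := fun p => lam p = 1 ∨ lam p = 2 ∨ ∃ i, 2 ≤ i ∧ i ≤ d ∧ p = f i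
  have hfB : ∀ i ≤ 1, ¬ B (f i) := by
    have hpos' : 1 ≤ d := hpos
    rintro i hi (h | h | ⟨j, h1, h2, h⟩)
    · have := hf0 i (by omega)
      omega
    · have := hf0 i (by omega)
      omega
    · exact hinj i j (by omega) h2 h
  obtain ⟨b, hb, hb1⟩ := h0.2
  obtain ⟨c, hcd, hc2⟩ := hd.2
  have hbc : F.JoinedIn B b c := by
    refine ((h1 b hb1).mono fun p hp => Or.inl hp).trans ?_
    refine .head ⟨huv, Or.inl hu, Or.inr (Or.inl hv)⟩ ?_
    exact ((h2 c hc2).mono fun p hp => Or.inr (Or.inl hp)).symm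
  have hend : ∃ c', B c' ∧ F.Adj (f 1) c' ∧ F.JoinedIn B b c' := by
    rcases Nat.lt_or_ge 1 d with h | h
    · have hfB' : ∀ k, 2 ≤ k → k ≤ d → B (f k) := fun k h1 h2 => Or.inr (Or.inr ⟨k, h1, h2, rfl⟩)
      refine ⟨f 2, hfB' 2 le_rfl h, (hR 1 h).1, ?_⟩
      refine (hbc.tail ⟨hcd.symm, Or.inr (Or.inl hc2), hfB' d h le_rfl⟩).trans ?_
      exact JoinedIn.symm (JoinedIn.of_chain h hfB' fun k _ h2 => (hR k h2).1)
    · obtain rfl : d = 1 := by omega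
      exact ⟨c, Or.inr (Or.inl hc2), hcd, hbc⟩
  obtain ⟨c', hc', h1c, hbc'⟩ := hend
  obtain ⟨z, hz, h0z, h1z⟩ := hF.exists_common_adj (hR 0 hpos).1 (hfB 0 (by omega))
    (hfB 1 le_rfl) (Or.inl hb1) hc' hb h1c hbc'
  rcases hz with h | h | ⟨i, hi, hid, rfl⟩
  · have := hP 1 hpos ⟨hf0 1 hpos, z, h1z, h⟩
    omega
  · have := hQ 0 (Nat.zero_le _) ⟨h0.1, z, h0z, h⟩
    omega
  · have := hch 0 i (by omega) hid ⟨h0z, h0.1, hf0 i hid⟩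
    omega

/-- If `u` and `v` are adjacent, chordality separates the sides. Otherwise every vertex of `VS` sees
both `u` and `v`; since it cannot be a contact, it has label `3`, so a walk between the sides would
avoid `VS` altogether. -/
theorem IsGrowing.isSeparating (hF : F.IsChordalGraph) {x y : V} {VS : Finset V}
    {ES : Finset (Sym2 V)} {lam : V → ℕ} (h : F.IsTightSeparator x y VS ES)
    (hg : F.IsGrowing x y VS ES lam) (hc : ∀ w, ¬ F.IsContact lam 2 w) :
    F.IsSeparating x y VS ES lam := by
  obtain ⟨u, v, hu, hv, hle, h3, h1, h2, huv⟩ := hg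
  have hcut : ∀ p q, F.Adj p q → lam p = 1 → lam q = 2 → s(p, q) ∈ ES := by
    intro p q hpq hp hq
    by_contra hn
    have hxp := (h1 p hp).1
    have hyq := (h2 q hq).1
    exact h.sep ((hxp.tail ⟨hpq, hxp.notMem h.left, hyq.notMem h.right, hn⟩).trans hyq.symm)
  have hstep : ∀ p q, F.StepAvoiding VS ES p q → F.LabelStep lam p q := fun p q hpq =>
    ⟨hpq.1, fun h => hpq.2.1 (h3 p h), fun h => hpq.2.2.1 (h3 q h),
      fun h => hpq.2.2.2 (hcut p q hpq.1 h.1 h.2),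
      fun h => hpq.symm.2.2.2 (hcut q p hpq.1.symm h.2 h.1)⟩
  refine ⟨h3, hcut, ⟨u, hu, reflTransGen_mono hstep (h1 u hu).1⟩,
    ⟨v, hv, reflTransGen_mono hstep (h2 v hv).1⟩, ?_⟩
  rcases huv with huv | ⟨rfl, hS⟩
  · exact fun p q => hF.not_reflTransGen_labelStep hle hu hv huv (fun p hp => (h1 p hp).2)
      (fun p hp => (h2 p hp).2) hc
  · intro p q hp hq hpq
    have hS3 : ∀ s ∈ VS, lam s = 3 := by
      intro s hs
      have hs3 := hle s
      rcases (show lam s = 0 ∨ lam s = 1 ∨ lam s = 2 ∨ lam s = 3 by omega) with h' | h' | h' | h'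
      · exact absurd ⟨h', ⟨u, (hS s hs).1, hu⟩, v, (hS s hs).2, hv⟩ (hc s)
      · exact absurd hs ((h1 s h').1.notMem h.left)
      · exact absurd hs ((h2 s h').1.notMem h.right)
      · exact h'
    have hpq' : F.JoinedAvoiding VS ∅ p q := reflTransGen_mono (fun p q hpq =>
      ⟨hpq.1, fun h => hpq.2.1 (hS3 p h), fun h => hpq.2.2.1 (hS3 q h), by simp⟩) hpq
    exact h.sep (((h1 p hp).1.trans hpq').trans (h2 q hq).1.symm)

/-- If `w` is not in `VS`, consider its edge to a neighbour on the side of `x`. Either the edge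
survives and `w` is in the component of `x`, or it lies in `ES` and tightness puts `w` in one of the
two components. -/
theorem IsGrowing.exists_update [DecidableEq V] {x y : V} {VS : Finset V}
    {ES : Finset (Sym2 V)} {lam : V → ℕ} (h : F.IsTightSeparator x y VS ES)
    (hg : F.IsGrowing x y VS ES lam) {w : V} (hw : F.IsContact lam 2 w) :
    F.IsGrowing x y VS ES (Function.update lam w 3) ∨
      F.IsGrowing x y VS ES (Function.update lam w 1) ∨
      F.IsGrowing x y VS ES (Function.update lam w 2) := by
  obtain ⟨u, v, hu, hv, hle, h3, h1, h2, huv⟩ := hg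
  obtain ⟨hw0, ⟨p, hwp, hp⟩, q, hwq, hq⟩ := hw
  have hxp := (h1 p hp).1
  have hyq := (h2 q hq).1
  -- Since `w` was unassigned, no nonzero label is overwritten, and connections inside a side
  -- persist.
  have hval : ∀ c d z, d ≠ 0 → lam z = d → Function.update lam w c z = d := by
    intro c d z hd hz
    rw [Function.update_of_ne (by rintro rfl; omega), hz]
  have hinv : ∀ c d z, d ≠ c → Function.update lam w c z = d → lam z = d := by
    intro c d z hd hz
    by_cases hzw : z = w
    · subst hzw
      simp only [Function.update_self] at hz
      exact absurd hz.symm hd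
    · rwa [Function.update_of_ne hzw] at hz
  have hle' : ∀ c, c ≤ 3 → ∀ z, Function.update lam w c z ≤ 3 := by
    intro c hc z
    by_cases hzw : z = w
    · subst hzw
      simpa using hc
    · simpa [Function.update_of_ne hzw] using hle z
  have hmono : ∀ c d, d ≠ 0 → ∀ {a b}, F.JoinedIn (fun z => lam z = d) a b →
      F.JoinedIn (fun z => Function.update lam w c z = d) a b := fun c d hd _ _ hab =>
    hab.mono fun z hz => hval c d z hd hz
  have hcase : w ∈ VS ∨ F.JoinedAvoiding VS ES x w ∨ F.JoinedAvoiding VS ES y w := by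
    by_contra! hn
    obtain ⟨hwV, hxw, hyw⟩ := hn
    by_cases he : s(p, w) ∈ ES
    · rcases h.edge p w he with h' | h'
      · exact hyw h'.2
      · exact hxw h'.1
    · exact hxw (hxp.tail ⟨hwp.symm, hxp.notMem h.left, hwV, he⟩)
  rcases hcase with hV | hx | hy
  · left
    refine ⟨u, v, hval _ _ _ (by simp) hu, hval _ _ _ (by simp) hv, hle' 3 le_rfl, ?_, ?_, ?_, huv⟩
    · intro z hz
      by_cases hzw : z = w
      · exact hzw ▸ hV
      · rw [Function.update_of_ne hzw] at hz
        exact h3 z hz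
    · intro z hz
      have := h1 z (hinv _ _ _ (by simp) hz)
      exact ⟨this.1, hmono _ _ (by simp) this.2⟩
    · intro z hz
      have := h2 z (hinv _ _ _ (by simp) hz)
      exact ⟨this.1, hmono _ _ (by simp) this.2⟩
  · right; left
    refine ⟨u, v, hval _ _ _ (by simp) hu, hval _ _ _ (by simp) hv, hle' 1 (by simp),
      fun z hz => h3 z (hinv _ _ _ (by simp) hz), ?_, ?_, huv⟩
    · intro z hz
      by_cases hzw : z = w
      · subst hzw
        exact ⟨hx, .head ⟨hwp, by simp, hval _ _ _ (by simp) hp⟩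
          (hmono _ _ (by simp) (h1 p hp).2)⟩
      · rw [Function.update_of_ne hzw] at hz
        exact ⟨(h1 z hz).1, hmono _ _ (by simp) (h1 z hz).2⟩
    · intro z hz
      have := h2 z (hinv _ _ _ (by simp) hz)
      exact ⟨this.1, hmono _ _ (by simp) this.2⟩
  · right; right
    refine ⟨u, v, hval _ _ _ (by simp) hu, hval _ _ _ (by simp) hv, hle' 2 (by simp),
      fun z hz => h3 z (hinv _ _ _ (by simp) hz), ?_, ?_, huv⟩
    · intro z hz
      have := h1 z (hinv _ _ _ (by simp) hz)
      exact ⟨this.1, hmono _ _ (by simp) this.2⟩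
    · intro z hz
      by_cases hzw : z = w
      · subst hzw
        exact ⟨hy, .head ⟨hwq, by simp, hval _ _ _ (by simp) hq⟩
          (hmono _ _ (by simp) (h2 q hq).2)⟩
      · rw [Function.update_of_ne hzw] at hz
        exact ⟨(h2 z hz).1, hmono _ _ (by simp) (h2 z hz).2⟩

/-- Both edges at an unassigned vertex survive, so a contact would join the sides by a walk of
length two. -/
theorem IsSeparating.not_isContact {x y : V} {VS : Finset V} {ES : Finset (Sym2 V)} {lam : V → ℕ}
    (hs : F.IsSeparating x y VS ES lam) (w : V) : ¬ F.IsContact lam 2 w := by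
  rintro ⟨hw0, ⟨p, hwp, hp⟩, q, hwq, hq⟩
  refine hs.2.2.2.2 p q hp hq (.tail (.single (b := w) ⟨hwp.symm, ?_⟩) ⟨hwq, ?_⟩) <;> omega

/-- With no neighbour labelled `2`, the vertex `w` can move from label `0` to `1` without changing
`LabelStep`. It may belong to `VS` or lie outside the component of `x`, so `IsGrowing` can be lost
here; `IsSeparating` is the weaker property that survives absorption. -/
theorem IsSeparating.update [DecidableEq V] {x y : V} {VS : Finset V} {ES : Finset (Sym2 V)}
    {lam : V → ℕ} (hs : F.IsSeparating x y VS ES lam) {w : V} (hw : F.IsContact lam 1 w) :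
    F.IsSeparating x y VS ES (Function.update lam w 1) := by
  have hc := hs.not_isContact w
  obtain ⟨h3, hcut, ⟨u, hu, hxu⟩, ⟨v, hv, hyv⟩, hn⟩ := hs
  obtain ⟨hw0, ⟨p, hwp, hp⟩, -⟩ := hw
  have hw2 : ∀ z, F.Adj w z → lam z ≠ 2 := fun z hz h2 => hc ⟨hw0, ⟨p, hwp, hp⟩, z, hz, h2⟩
  have hup : ∀ z, z ≠ w → Function.update lam w 1 z = lam z := fun z hz =>
    Function.update_of_ne hz _ _
  have hself : Function.update lam w 1 w = 1 := Function.update_self _ _ _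
  have hiff : ∀ a b, F.LabelStep (Function.update lam w 1) a b ↔ F.LabelStep lam a b := by
    intro a b
    by_cases hab : F.Adj a b
    · by_cases ha : a = w
      · subst ha
        have hb : b ≠ a := hab.ne'
        have := hw2 b hab
        simp only [LabelStep, hup b hb, hself, hw0]
        simp [this]
      · by_cases hb : b = w
        · subst hb
          have := hw2 a hab.symm
          simp only [LabelStep, hup a ha, hself, hw0]
          simp [this]
        · simp only [LabelStep, hup a ha, hup b hb]
    · simp [LabelStep, hab]
  have hrel : F.LabelStep (Function.update lam w 1) = F.LabelStep lam := by
    ext a b; exact hiff a b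
  have huw : u ≠ w := by rintro rfl; omega
  have hvw : v ≠ w := by rintro rfl; omega
  refine ⟨?_, ?_, ⟨u, (hup u huw).trans hu, hrel ▸ hxu⟩, ⟨v, (hup v hvw).trans hv, hrel ▸ hyv⟩, ?_⟩
  · intro z hz
    have hzw : z ≠ w := by rintro rfl; rw [hself] at hz; omega
    exact h3 z (by rwa [hup z hzw] at hz)
  · intro a b hab ha hb
    have hbw : b ≠ w := by rintro rfl; rw [hself] at hb; omega
    rw [hup b hbw] at hb
    by_cases haw : a = w
    · subst haw
      exact absurd hb (hw2 b hab)
    · exact hcut a b hab (by rwa [hup a haw] at ha) hb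
  · intro a b ha hb
    rw [hrel]
    have hbw : b ≠ w := by rintro rfl; rw [hself] at hb; omega
    rw [hup b hbw] at hb
    by_cases haw : a = w
    · subst haw
      exact fun h => hn p b hp hb (.head ⟨hwp.symm, by omega, by omega, by omega, by omega⟩ h)
    · exact hn a b (by rwa [hup a haw] at ha) hb

/-- A walk links `x` to a vertex labelled `1`, and in the absence of contacts label `1` spreads
along it. The walk from `y` to a vertex labelled `2` forbids label `1` at `y`. -/
theorem IsSeparating.labels {x y : V} {VS : Finset V} {ES : Finset (Sym2 V)} {lam : V → ℕ}
    (hle : ∀ p, lam p ≤ 3) (h : F.IsTightSeparator x y VS ES) (hs : F.IsSeparating x y VS ES lam)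
    (hc : ∀ w, ¬ F.IsContact lam 1 w) : lam x = 1 ∧ lam y ≠ 1 ∧ lam y ≠ 3 := by
  obtain ⟨h3, -, ⟨u, hu, hxu⟩, ⟨v, hv, hyv⟩, hn⟩ := hs
  refine ⟨?_, fun hy => hn y v hy hv hyv, fun hy => h.right (h3 y hy)⟩
  have hux := reflTransGen_symm (fun _ _ h => LabelStep.symm h) hxu
  clear hxu h
  induction hux with
  | refl => exact hu
  | @tail b c _ hbc ih =>
    obtain ⟨hadj, -, hc3, hn1, -⟩ := hbc
    have hlc := hle c
    rcases (show lam c = 0 ∨ lam c = 1 ∨ lam c = 2 by omega) with h' | h' | h'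
    · exact absurd ⟨h', ⟨b, hadj.symm, ih⟩, b, hadj.symm, ih⟩ (hc c)
    · exact h'
    · exact absurd ⟨ih, h'⟩ hn1

/-- The labeling in which `u` is labelled `1` and `v` is labelled `2`. -/
def initLabel [DecidableEq V] (u v : V) : V → ℕ := Function.update (Function.update (fun _ => 0) u 1) v 2

theorem initLabel_eq_one [DecidableEq V] {u v p : V} : initLabel u v p = 1 → p = u := by
  unfold initLabel
  intro h
  by_cases hv : p = v
  · simp [hv] at h
  · by_contra hu
    simp [Function.update_of_ne hv, Function.update_of_ne hu] at h

theorem initLabel_eq_two [DecidableEq V] {u v p : V} : initLabel u v p = 2 → p = v := by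
  unfold initLabel
  intro h
  by_contra hv
  rw [Function.update_of_ne hv] at h
  by_cases hu : p = u
  · simp [hu] at h
  · simp [Function.update_of_ne hu] at h

theorem initLabel_le [DecidableEq V] (u v p : V) : initLabel u v p ≤ 2 := by
  unfold initLabel Function.update
  split <;> [simp; (split <;> simp)]

/-- The starting pair is the two ends of a deleted edge, or two vertices complete to `VS` if no edge
is deleted. -/
theorem IsTightSeparator.exists_isGrowing [DecidableEq V] (hF : F.IsChordalGraph) {x y : V} {VS : Finset V}
    {ES : Finset (Sym2 V)} (h : F.IsTightSeparator x y VS ES) :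
    ∃ u v, F.IsGrowing x y VS ES (initLabel u v) := by
  have key : ∀ u v, F.JoinedAvoiding VS ES x u → F.JoinedAvoiding VS ES y v →
      (F.Adj u v ∨ ES = ∅ ∧ ∀ s ∈ VS, F.Adj s u ∧ F.Adj s v) →
      F.IsGrowing x y VS ES (initLabel u v) := by
    intro u v hu hv huv
    have hne : u ≠ v := by
      rintro rfl
      exact h.sep (hu.trans hv.symm)
    refine ⟨u, v, by simp [initLabel, hne], by simp [initLabel],
      fun p => (initLabel_le u v p).trans (by simp), fun p hp => ?_, fun p hp => ?_, fun p hp => ?_,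
      huv⟩
    · have := initLabel_le u v p
      omega
    · obtain rfl := initLabel_eq_one hp
      exact ⟨hu, .refl⟩
    · obtain rfl := initLabel_eq_two hp
      exact ⟨hv, .refl⟩
  rcases ES.eq_empty_or_nonempty with rfl | ⟨e, he⟩
  · obtain ⟨u, v, hu, hv, hS⟩ := h.exists_adj hF
    exact ⟨u, v, key u v hu hv (Or.inr ⟨rfl, hS⟩)⟩
  · induction e with
    | _ p q =>
      have hadj : F.Adj p q := h.edge_mem _ he
      rcases h.edge p q he with h' | h'
      · exact ⟨p, q, key p q h'.1 h'.2 (Or.inl hadj)⟩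
      · exact ⟨q, p, key q p h'.1 h'.2 (Or.inl hadj.symm)⟩

/-! ### Budgets, the search invariant and soundness -/

section Fintype

variable [Fintype V]

open scoped Classical in
/-- The vertices labelled `3`. -/
noncomputable def labelVertices (lam : V → ℕ) : Finset V := Finset.univ.filter fun p => lam p = 3

open scoped Classical in
/-- The pairs of adjacent vertices labelled `1` and `2`. -/
noncomputable def labelEdges (F : SimpleGraph V) (lam : V → ℕ) : Finset (V × V) :=
  Finset.univ.filter fun p => F.Adj p.1 p.2 ∧ lam p.1 = 1 ∧ lam p.2 = 2

/-- The labels orient each cut edge from `1` to `2`, so no edge is counted twice. -/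
theorem card_labelEdges_le {ES : Finset (Sym2 V)} {lam : V → ℕ}
    (h : ∀ p q, F.Adj p q → lam p = 1 → lam q = 2 → s(p, q) ∈ ES) :
    (F.labelEdges lam).card ≤ ES.card := by
  refine Finset.card_le_card_of_injOn (fun p => s(p.1, p.2)) ?_ ?_
  · intro p hp
    simp only [labelEdges, Finset.coe_filter, Finset.mem_univ, true_and, Set.mem_ofPred_eq] at hp
    exact h _ _ hp.1 hp.2.1 hp.2.2
  · rintro ⟨p, q⟩ hp ⟨p', q'⟩ hp' he
    have h1 : F.Adj p q ∧ lam p = 1 ∧ lam q = 2 := by simpa [labelEdges] using hp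
    have h2 : F.Adj p' q' ∧ lam p' = 1 ∧ lam q' = 2 := by simpa [labelEdges] using hp'
    rcases Sym2.eq_iff.mp he with ⟨rfl, rfl⟩ | ⟨rfl, rfl⟩
    · rfl
    · exact absurd (h1.2.1.symm.trans h2.2.2) (by simp)

variable [DecidableEq V]

/-- An invariant of the search for a separator: every labeling from which the search has to
succeed is within the budgets, has a successor with the same property, and otherwise is an
answer. -/
structure IsSearchInvariant (F : SimpleGraph V) (x y : V) (a b : ℕ) (Good : (V → ℕ) → Prop) :
    Prop where
  budget : ∀ lam, Good lam → (labelVertices lam).card ≤ a ∧ (F.labelEdges lam).card ≤ b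
  branch : ∀ lam w, Good lam → F.IsContact lam 2 w → Good (Function.update lam w 3) ∨
    Good (Function.update lam w 1) ∨ Good (Function.update lam w 2)
  extend : ∀ lam w, Good lam → (∀ z, ¬ F.IsContact lam 2 z) → F.IsContact lam 1 w →
    Good (Function.update lam w 1)
  answer : ∀ lam, Good lam → (∀ z, ¬ F.IsContact lam 2 z) → (∀ z, ¬ F.IsContact lam 1 z) →
    lam x = 1 ∧ lam y ≠ 1 ∧ lam y ≠ 3

/-- Good labelings are those that agree with one fixed tight separator: growing before the contacts
with both sides are exhausted, separating during absorption. -/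
theorem exists_isSearchInvariant (hF : F.IsChordalGraph) {x y : V} {a b : ℕ}
    (h : ∃ VS ES, F.IsMixedSeparatorOfSizeAtMost x y a b VS ES) :
    ∃ Good, F.IsSearchInvariant x y a b Good ∧ ∃ u v, Good (initLabel u v) := by
  obtain ⟨VS, ES, ht, ha, hb⟩ := IsMixedSeparatorOfSizeAtMost.exists_tight h
  refine ⟨fun lam => (∀ p, lam p ≤ 3) ∧
    (F.IsGrowing x y VS ES lam ∨ F.IsSeparating x y VS ES lam), ⟨?_, ?_, ?_, ?_⟩, ?_⟩
  · rintro lam ⟨hle, hg⟩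
    have h3 : ∀ p, lam p = 3 → p ∈ VS := by
      rcases hg with ⟨u, v, -, -, -, h3, -⟩ | hs
      · exact h3
      · exact hs.1
    have hcut : ∀ p q, F.Adj p q → lam p = 1 → lam q = 2 → s(p, q) ∈ ES := by
      rcases hg with ⟨u, v, -, -, -, -, h1, h2, -⟩ | hs
      · intro p q hpq hp hq
        by_contra hn
        have hxp := (h1 p hp).1
        have hyq := (h2 q hq).1
        exact ht.sep ((hxp.tail ⟨hpq, hxp.notMem ht.left, hyq.notMem ht.right, hn⟩).trans hyq.symm)
      · exact hs.2.1
    refine ⟨(Finset.card_le_card ?_).trans ha, (card_labelEdges_le hcut).trans hb⟩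
    intro p hp
    exact h3 p (by simpa [labelVertices] using hp)
  · rintro lam w ⟨hle, hg⟩ hw
    have hle' : ∀ {c}, F.IsGrowing x y VS ES (Function.update lam w c) →
        ∀ p, Function.update lam w c p ≤ 3 := fun ⟨_, _, _, _, h, _⟩ => h
    rcases hg with hg | hs
    · rcases hg.exists_update ht hw with h' | h' | h'
      · exact Or.inl ⟨hle' h', Or.inl h'⟩
      · exact Or.inr (Or.inl ⟨hle' h', Or.inl h'⟩)
      · exact Or.inr (Or.inr ⟨hle' h', Or.inl h'⟩)
    · exact absurd hw (hs.not_isContact w)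
  · rintro lam w ⟨hle, hg⟩ hc hw
    have hs := hg.elim (fun hg => hg.isSeparating hF ht hc) id
    refine ⟨fun p => ?_, Or.inr (hs.update hw)⟩
    by_cases hp : p = w
    · simp [hp]
    · simpa [Function.update_of_ne hp] using hle p
  · rintro lam ⟨hle, hg⟩ hc hc1
    exact (hg.elim (fun hg => hg.isSeparating hF ht hc) id).labels hle ht hc1
  · obtain ⟨u, v, huv⟩ := ht.exists_isGrowing hF
    exact ⟨u, v, fun p => (initLabel_le u v p).trans (by simp), Or.inl huv⟩

/-- A labeling in which the side of `x` is closed describes a separator. -/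
theorem isMixedSeparator_of_labels {x y : V} {lam : V → ℕ} (hle : ∀ p, lam p ≤ 3)
    (hc : ∀ w, ¬ F.IsContact lam 1 w) (hx : lam x = 1) (hy1 : lam y ≠ 1) (hy3 : lam y ≠ 3) :
    F.IsMixedSeparator x y (labelVertices lam)
      ((F.labelEdges lam).image fun p => s(p.1, p.2)) := by
  rw [isMixedSeparator_iff]
  refine ⟨?_, by simp [labelVertices, hx], by simp [labelVertices, hy3], ?_⟩
  · intro e he
    simp only [Finset.coe_image, Set.mem_image, labelEdges, Finset.coe_filter, Finset.mem_univ,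
      true_and, Set.mem_ofPred_eq] at he
    obtain ⟨p, hp, rfl⟩ := he
    exact hp.1
  · intro h
    -- Label `1` spreads along surviving edges: label `0` would be a contact, label `2` a cut edge,
    -- label `3` a deleted vertex.
    have : ∀ z, F.JoinedAvoiding (labelVertices lam)
        ((F.labelEdges lam).image fun p => s(p.1, p.2)) x z → lam z = 1 := by
      intro z hz
      induction hz with
      | refl => exact hx
      | @tail p q _ hpq ih =>
        obtain ⟨hadj, -, hq, he⟩ := hpq
        have h3 : lam q ≠ 3 := by simpa [labelVertices] using hq
        have hlq := hle q
        rcases (show lam q = 0 ∨ lam q = 1 ∨ lam q = 2 by omega) with h' | h' | h'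
        · exact absurd ⟨h', ⟨p, hadj.symm, ih⟩, p, hadj.symm, ih⟩ (hc q)
        · exact h'
        · refine absurd (Finset.mem_image.mpr ⟨(p, q), ?_, rfl⟩) he
          simp [labelEdges, hadj, ih, h']
    exact hy1 (this y h)

theorem labelVertices_update_lt {lam : V → ℕ} {w : V} (hw : lam w = 0) :
    (labelVertices lam).card + 1 ≤ (labelVertices (Function.update lam w 3)).card := by
  refine Finset.card_lt_card (Finset.ssubset_iff.mpr ⟨w, by simp [labelVertices, hw], ?_⟩)
  intro p hp
  by_cases hpw : p = w
  · simp [labelVertices, hpw]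
  · simpa [labelVertices, Function.update_of_ne hpw, hpw] using hp

theorem labelVertices_update_le {lam : V → ℕ} {w : V} (hw : lam w = 0) (c : ℕ) :
    (labelVertices lam).card ≤ (labelVertices (Function.update lam w c)).card := by
  refine Finset.card_le_card fun p hp => ?_
  have hp3 : lam p = 3 := by simpa [labelVertices] using hp
  have hpw : p ≠ w := by rintro rfl; omega
  simpa [labelVertices, Function.update_of_ne hpw] using hp3

theorem labelEdges_subset_update {lam : V → ℕ} {w : V} (hw : lam w = 0) (c : ℕ) :
    F.labelEdges lam ⊆ F.labelEdges (Function.update lam w c) := by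
  intro p hp
  have hp' : F.Adj p.1 p.2 ∧ lam p.1 = 1 ∧ lam p.2 = 2 := by simpa [labelEdges] using hp
  have h1 : p.1 ≠ w := by rintro rfl; omega
  have h2 : p.2 ≠ w := by rintro rfl; omega
  simpa [labelEdges, Function.update_of_ne h1, Function.update_of_ne h2] using hp'

/-- The vertex `w` already has a neighbour on the side it does not join, and that edge is newly cut.
-/
theorem labelEdges_update_lt {lam : V → ℕ} {w : V} (hw : F.IsContact lam 2 w) {c : ℕ}
    (hc : c = 1 ∨ c = 2) :
    (F.labelEdges lam).card + 1 ≤ (F.labelEdges (Function.update lam w c)).card := by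
  obtain ⟨hw0, ⟨p, hwp, hp⟩, q, hwq, hq⟩ := hw
  have hpw : p ≠ w := hwp.ne'
  have hqw : q ≠ w := hwq.ne'
  refine Finset.card_lt_card (Finset.ssubset_iff_of_subset (labelEdges_subset_update hw0 c) |>.mpr ?_)
  rcases hc with rfl | rfl
  · exact ⟨(w, q), by simp [labelEdges, hwq, hq, Function.update_of_ne hqw],
      by simp [labelEdges, hw0]⟩
  · exact ⟨(p, w), by simp [labelEdges, hwp.symm, hp, Function.update_of_ne hpw],
      by simp [labelEdges, hw0]⟩

end Fintype

end SimpleGraph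

namespace Lisp

/-! ### Evaluation within a time bound -/

/-- `e` evaluates to `v` in at most `T` steps. -/
def Ev (P : Program) (env : List Val) (e : Expr) (v : Val) (T : ℕ) : Prop :=
  ∃ t, t ≤ T ∧ Eval P env e v t

/-- The value of an expression without conditionals, local definitions and calls. -/
def Expr.value (env : List Val) : Expr → Option Val
  | .var i => env[i]?
  | .const n => some (.num n)
  | .succ e => match e.value env with
    | some (.num n) => some (.num (n + 1))
    | _ => none
  | .sub e₁ e₂ => match e₁.value env, e₂.value env with
    | some (.num m), some (.num n) => some (.num (m - n))
    | _, _ => none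
  | .eq e₁ e₂ => match e₁.value env, e₂.value env with
    | some (.num m), some (.num n) => some (.num (if m = n then 1 else 0))
    | _, _ => none
  | .cons e₁ e₂ => match e₁.value env, e₂.value env with
    | some u, some v => some (.cons u v)
    | _, _ => none
  | .fst e => match e.value env with
    | some (.cons u _) => some u
    | _ => none
  | .snd e => match e.value env with
    | some (.cons _ v) => some v
    | _ => none
  | _ => none

/-- The number of nodes of an expression without conditionals, local definitions and calls. -/
def Expr.size : Expr → ℕ
  | .var _ => 1
  | .const _ => 1
  | .succ e => e.size + 1
  | .sub e₁ e₂ => e₁.size + e₂.size + 1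
  | .eq e₁ e₂ => e₁.size + e₂.size + 1
  | .cons e₁ e₂ => e₁.size + e₂.size + 1
  | .fst e => e.size + 1
  | .snd e => e.size + 1
  | _ => 0

variable {P : Program} {env : List Val} {e e₁ e₂ e₃ : Expr} {u v : Val} {T T₁ T₂ m n : ℕ}

/-- Evaluation of straight-line code becomes a computation, so such subterms are settled below by
`rfl`, at cost `Expr.size`. -/
theorem Expr.eval_of_value (h : e.value env = some v) : Eval P env e v e.size := by
  induction e generalizing v with
  | var i => exact .var h
  | const n => obtain rfl := Option.some.inj h; exact .const
  | succ e ih =>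
    simp only [Expr.value] at h
    split at h <;> simp_all
    subst h
    exact .succ ih
  | sub e₁ e₂ ih₁ ih₂ =>
    simp only [Expr.value] at h
    split at h <;> simp_all
    subst h
    exact .sub ih₁ ih₂
  | eq e₁ e₂ ih₁ ih₂ =>
    simp only [Expr.value] at h
    split at h <;> simp_all
    subst h
    exact .eq ih₁ ih₂
  | cons e₁ e₂ ih₁ ih₂ =>
    simp only [Expr.value] at h
    split at h <;> simp_all
    subst h
    exact .cons ih₁ ih₂
  | fst e ih =>
    simp only [Expr.value] at h
    split at h <;> simp_all
    exact .fst ih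
  | snd e ih =>
    simp only [Expr.value] at h
    split at h <;> simp_all
    exact .snd ih
  | ite | letE | call => simp [Expr.value] at h

theorem Ev.value (h : e.value env = some v) : Ev P env e v e.size :=
  ⟨_, le_rfl, Expr.eval_of_value h⟩

theorem Ev.mono (h : Ev P env e v T₁) (hT : T₁ ≤ T) : Ev P env e v T :=
  let ⟨t, ht, he⟩ := h
  ⟨t, ht.trans hT, he⟩

theorem Ev.succ (h : Ev P env e (.num n) T) : Ev P env (.succ e) (.num (n + 1)) (T + 1) :=
  let ⟨_, ht, he⟩ := h
  ⟨_, by omega, .succ he⟩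

theorem Ev.sub (h₁ : Ev P env e₁ (.num m) T₁) (h₂ : Ev P env e₂ (.num n) T₂) :
    Ev P env (.sub e₁ e₂) (.num (m - n)) (T₁ + T₂ + 1) :=
  let ⟨_, ht₁, he₁⟩ := h₁
  let ⟨_, ht₂, he₂⟩ := h₂
  ⟨_, by omega, .sub he₁ he₂⟩

theorem Ev.eqTrue (h₁ : Ev P env e₁ (.num m) T₁) (h₂ : Ev P env e₂ (.num n) T₂) (h : m = n) :
    Ev P env (.eq e₁ e₂) (.num 1) (T₁ + T₂ + 1) :=
  let ⟨_, ht₁, he₁⟩ := h₁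
  let ⟨_, ht₂, he₂⟩ := h₂
  ⟨_, Nat.add_le_add_right (Nat.add_le_add ht₁ ht₂) 1, by simpa [h] using Eval.eq he₁ he₂⟩

theorem Ev.eqFalse (h₁ : Ev P env e₁ (.num m) T₁) (h₂ : Ev P env e₂ (.num n) T₂) (h : m ≠ n) :
    Ev P env (.eq e₁ e₂) (.num 0) (T₁ + T₂ + 1) :=
  let ⟨_, ht₁, he₁⟩ := h₁
  let ⟨_, ht₂, he₂⟩ := h₂
  ⟨_, Nat.add_le_add_right (Nat.add_le_add ht₁ ht₂) 1, by simpa [h] using Eval.eq he₁ he₂⟩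

theorem Ev.cons (h₁ : Ev P env e₁ u T₁) (h₂ : Ev P env e₂ v T₂) :
    Ev P env (.cons e₁ e₂) (.cons u v) (T₁ + T₂ + 1) :=
  let ⟨_, ht₁, he₁⟩ := h₁
  let ⟨_, ht₂, he₂⟩ := h₂
  ⟨_, by omega, .cons he₁ he₂⟩

theorem Ev.iteTrue (h₁ : Ev P env e₁ u T₁) (hu : u ≠ .num 0) (h₂ : Ev P env e₂ v T₂) :
    Ev P env (.ite e₁ e₂ e₃) v (T₁ + T₂ + 1) :=
  let ⟨_, ht₁, he₁⟩ := h₁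
  let ⟨_, ht₂, he₂⟩ := h₂
  ⟨_, by omega, .iteTrue he₁ hu he₂⟩

theorem Ev.iteFalse (h₁ : Ev P env e₁ (.num 0) T₁) (h₃ : Ev P env e₃ v T₂) :
    Ev P env (.ite e₁ e₂ e₃) v (T₁ + T₂ + 1) :=
  let ⟨_, ht₁, he₁⟩ := h₁
  let ⟨_, ht₂, he₂⟩ := h₃
  ⟨_, by omega, .iteFalse he₁ he₂⟩

theorem Ev.letE (h₁ : Ev P env e₁ u T₁) (h₂ : Ev P (u :: env) e₂ v T₂) :
    Ev P env (.letE e₁ e₂) v (T₁ + T₂ + 1) :=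
  let ⟨_, ht₁, he₁⟩ := h₁
  let ⟨_, ht₂, he₂⟩ := h₂
  ⟨_, by omega, .letE he₁ he₂⟩

/-- The function `f` maps `u` to `v` in at most `T` steps. -/
def Computes (P : Program) (f : ℕ) (u v : Val) (T : ℕ) : Prop :=
  ∃ body, P.funs[f]? = some body ∧ Ev P [u] body v T

theorem Computes.mono {f : ℕ} (h : Computes P f u v T₁) (hT : T₁ ≤ T) : Computes P f u v T :=
  let ⟨body, hb, he⟩ := h
  ⟨body, hb, he.mono hT⟩

theorem Ev.call {f : ℕ} (h₁ : Ev P env e u T₁) (h₂ : Computes P f u v T₂) :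
    Ev P env (.call f e) v (T₁ + T₂ + 1) :=
  let ⟨_, ht₁, he₁⟩ := h₁
  let ⟨_, hb, _, ht₂, he₂⟩ := h₂
  ⟨_, by omega, .call he₁ hb he₂⟩

/-! ### The program -/

/-- The argument of the function. -/
abbrev arg : Expr := .var 0

/-- Does a row of the matrix have an entry in a column with label `c`?
The argument is `(c, (row, labels))`. -/
def hitBody : Expr :=
  .ite (.fst (.snd arg))
    (.ite (.ite (.fst (.fst (.snd arg))) (.eq (.fst (.snd (.snd arg))) (.fst arg)) (.const 0))
      (.const 1)
      (.call 0 (.cons (.fst arg) (.cons (.snd (.fst (.snd arg))) (.snd (.snd (.snd arg)))))))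
    (.const 0)

/-- The recursive call in `findBody`. -/
def findNext : Expr :=
  .call 1 (.cons (.fst arg) (.cons (.fst (.snd arg)) (.cons (.succ (.fst (.snd (.snd arg))))
    (.cons (.snd (.fst (.snd (.snd (.snd arg))))) (.snd (.snd (.snd (.snd (.snd arg)))))))))

/-- The successor of the first vertex with label `0` and with neighbours labelled `1` and `c`.
The argument is `(c, (labels, (i, (remaining rows, remaining labels))))`. -/
def findBody : Expr :=
  .ite (.fst (.snd (.snd (.snd arg))))
    (.ite (.fst (.snd (.snd (.snd (.snd arg))))) findNext
      (.ite (.call 0 (.cons (.const 1)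
          (.cons (.fst (.fst (.snd (.snd (.snd arg))))) (.fst (.snd arg)))))
        (.ite (.call 0 (.cons (.fst arg)
            (.cons (.fst (.fst (.snd (.snd (.snd arg))))) (.fst (.snd arg)))))
          (.succ (.fst (.snd (.snd arg)))) findNext)
        findNext))
    (.const 0)

/-- Replace an entry of a list. The argument is `(i, (c, list))`. -/
def setBody : Expr :=
  .ite (.snd (.snd arg))
    (.ite (.fst arg)
      (.cons (.fst (.snd (.snd arg)))
        (.call 2 (.cons (.sub (.fst arg) (.const 1))
          (.cons (.fst (.snd arg)) (.snd (.snd (.snd arg)))))))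
      (.cons (.fst (.snd arg)) (.snd (.snd (.snd arg)))))
    (.const 0)

/-- The vertices with label `3`. The argument is `(i, remaining labels)`. -/
def delsBody : Expr :=
  .ite (.snd arg)
    (.letE (.call 3 (.cons (.succ (.fst arg)) (.snd (.snd arg))))
      (.ite (.eq (.fst (.snd (.var 1))) (.const 3)) (.cons (.fst (.var 1)) (.var 0)) (.var 0)))
    (.const 0)

/-- The pairs `(i, j)` with label `2` at `j` that a row contributes.
The argument is `(i, (j, (list, (remaining row, remaining labels))))`. -/
def rowCutBody : Expr :=
  .ite (.fst (.snd (.snd (.snd arg))))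
    (.letE (.call 4 (.cons (.fst arg) (.cons (.succ (.fst (.snd arg)))
        (.cons (.fst (.snd (.snd arg))) (.cons (.snd (.fst (.snd (.snd (.snd arg)))))
          (.snd (.snd (.snd (.snd (.snd arg))))))))))
      (.ite (.ite (.fst (.fst (.snd (.snd (.snd (.var 1))))))
          (.eq (.fst (.snd (.snd (.snd (.snd (.var 1)))))) (.const 2)) (.const 0))
        (.cons (.cons (.fst (.var 1)) (.fst (.snd (.var 1)))) (.var 0))
        (.var 0)))
    (.fst (.snd (.snd arg)))

/-- The pairs of adjacent vertices with labels `1` and `2`.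
The argument is `(i, (labels, (remaining rows, remaining labels)))`. -/
def cutsBody : Expr :=
  .ite (.fst (.snd (.snd arg)))
    (.letE (.call 5 (.cons (.succ (.fst arg)) (.cons (.fst (.snd arg))
        (.cons (.snd (.fst (.snd (.snd arg)))) (.snd (.snd (.snd (.snd arg))))))))
      (.ite (.eq (.fst (.snd (.snd (.snd (.var 1))))) (.const 1))
        (.call 4 (.cons (.fst (.var 1)) (.cons (.const 0) (.cons (.var 0)
          (.cons (.fst (.fst (.snd (.snd (.var 1))))) (.fst (.snd (.var 1))))))))
        (.var 0)))
    (.const 0)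

/-- The length of a list. -/
def lengthBody : Expr := .ite arg (.succ (.call 6 (.snd arg))) (.const 0)

/-- A list of zeros of the same length. -/
def zerosBody : Expr := .ite arg (.cons (.const 0) (.call 7 (.snd arg))) (.const 0)

/-- An entry of a list. The argument is `(i, list)`. -/
def nthBody : Expr :=
  .ite (.fst arg) (.call 8 (.cons (.sub (.fst arg) (.const 1)) (.snd (.snd arg))))
    (.fst (.snd arg))

/-- The three branches at a vertex that sees both sides. The variables are the successor of the
vertex, the edges and the vertices deleted so far, and the argument of `searchBody`. -/
def branchBody : Expr :=
  .letE (.call 9 (.cons (.fst (.var 3))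
    (.call 2 (.cons (.sub (.var 0) (.const 1)) (.cons (.const 3) (.snd (.var 3)))))))
  (.ite (.var 0) (.var 0)
  -- Each `letE` pushes one value, so the indices of the older variables grow by one. A found
  -- separator is a cons cell and counts as true, which ends the search early.
  (.letE (.call 9 (.cons (.fst (.var 4))
    (.call 2 (.cons (.sub (.var 1) (.const 1)) (.cons (.const 1) (.snd (.var 4)))))))
  (.ite (.var 0) (.var 0)
  (.call 9 (.cons (.fst (.var 5))
    (.call 2 (.cons (.sub (.var 2) (.const 1)) (.cons (.const 2) (.snd (.var 5))))))))))

/-- The answer if the side of `x` is closed. The variables are `0`, `0` and those of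
`branchBody` without the first. -/
def answerBody : Expr :=
  .ite (.eq (.call 8 (.cons (.fst (.snd (.fst (.var 4)))) (.snd (.var 4)))) (.const 1))
    (.letE (.call 8 (.cons (.fst (.snd (.snd (.fst (.var 4))))) (.snd (.var 4))))
    (.ite (.eq (.var 0) (.const 1)) (.const 0)
    (.ite (.eq (.var 0) (.const 3)) (.const 0)
      (.cons (.var 4) (.var 3)))))
    (.const 0)

/-- The case that no vertex sees both sides, with the variables of `branchBody`. -/
def extendBody : Expr :=
  .letE (.call 1 (.cons (.const 1) (.cons (.snd (.var 3)) (.cons (.const 0)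
    (.cons (.fst (.fst (.var 3))) (.snd (.var 3)))))))
  (.ite (.var 0)
    (.call 9 (.cons (.fst (.var 4))
      (.call 2 (.cons (.sub (.var 0) (.const 1)) (.cons (.const 1) (.snd (.var 4)))))))
    answerBody)

/-- The search below a labeling. The argument is `(input, labels)`. -/
def searchBody : Expr :=
  .letE (.call 3 (.cons (.const 0) (.snd arg)))
  (.letE (.call 5 (.cons (.const 0)
    (.cons (.snd (.var 1)) (.cons (.fst (.fst (.var 1))) (.snd (.var 1))))))
  -- Truncated subtraction is nonzero exactly when the budget is exceeded.
  (.ite (.sub (.call 6 (.var 1)) (.fst (.snd (.snd (.snd (.fst (.var 2))))))) (.const 0)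
  (.ite (.sub (.call 6 (.var 0)) (.snd (.snd (.snd (.snd (.fst (.var 2))))))) (.const 0)
  (.letE (.call 1 (.cons (.const 2) (.cons (.snd (.var 2)) (.cons (.const 0)
    (.cons (.fst (.fst (.var 2))) (.snd (.var 2)))))))
  (.ite (.var 0) branchBody extendBody)))))

/-- The searches from the labelings with `u` and `0, …, v` on the two sides.
The argument is `(input, (u, v))`. -/
def innerBody : Expr :=
  .letE (.call 9 (.cons (.fst arg) (.call 2 (.cons (.snd (.snd arg)) (.cons (.const 2)
    (.call 2 (.cons (.fst (.snd arg)) (.cons (.const 1) (.call 7 (.fst (.fst arg)))))))))))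
  (.ite (.var 0) (.var 0)
  (.ite (.snd (.snd (.var 1)))
    (.call 10 (.cons (.fst (.var 1))
      (.cons (.fst (.snd (.var 1))) (.sub (.snd (.snd (.var 1))) (.const 1)))))
    (.const 0)))

/-- The searches from the labelings with `0, …, u` and any vertex on the two sides.
The argument is `(input, u)`. -/
def outerBody : Expr :=
  .letE (.call 10 (.cons (.fst arg)
    (.cons (.snd arg) (.sub (.call 6 (.fst (.fst arg))) (.const 1)))))
  (.ite (.var 0) (.var 0)
  (.ite (.snd (.var 1))
    (.call 11 (.cons (.fst (.var 1)) (.sub (.snd (.var 1)) (.const 1))))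
    (.const 0)))

/-- The program that searches for a mixed separator of a chordal graph. -/
def separatorProgram : Program where
  funs := [hitBody, findBody, setBody, delsBody, rowCutBody, cutsBody, lengthBody, zerosBody,
    nthBody, searchBody, innerBody, outerBody]
  main := .call 11 (.cons arg (.sub (.call 6 (.fst arg)) (.const 1)))

/-! ### The auxiliary functions on lists -/

/-- A list of numbers. -/
def nums (l : List ℕ) : Val := .ofList (l.map .num)

/-- A list of lists of numbers. -/
def matrix (M : List (List ℕ)) : Val := .ofList (M.map nums)

/-- A list of pairs of numbers. -/
def pairs (l : List (ℕ × ℕ)) : Val := .ofList (l.map fun p => .cons (.num p.1) (.num p.2))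

/-- `1` if a row has a nonzero entry in a column with label `c`. -/
def hit (c : ℕ) : List ℕ → List ℕ → ℕ
  | r :: row, l :: L => if r ≠ 0 ∧ l = c then 1 else hit c row L
  | _, _ => 0

/-- The successor of the first index with label `0` whose row hits the labels `1` and `c`. -/
def find (c : ℕ) (L : List ℕ) : ℕ → List (List ℕ) → List ℕ → ℕ
  | i, row :: rows, l :: ls =>
    if l = 0 ∧ hit 1 row L ≠ 0 ∧ hit c row L ≠ 0 then i + 1 else find c L (i + 1) rows ls
  | _, _, _ => 0

/-- The indices with label `3`. -/
def dels : ℕ → List ℕ → List ℕ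
  | i, l :: L => if l = 3 then i :: dels (i + 1) L else dels (i + 1) L
  | _, [] => []

/-- The pairs `(i, j)` with a nonzero entry and the label `2` at `j`. -/
def rowCut (i : ℕ) (acc : List (ℕ × ℕ)) : ℕ → List ℕ → List ℕ → List (ℕ × ℕ)
  | j, r :: row, l :: L =>
    if r ≠ 0 ∧ l = 2 then (i, j) :: rowCut i acc (j + 1) row L else rowCut i acc (j + 1) row L
  | _, _, _ => acc

/-- The pairs `(i, j)` with a nonzero entry and the labels `1` and `2`. -/
def cuts (L : List ℕ) : ℕ → List (List ℕ) → List ℕ → List (ℕ × ℕ)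
  | i, row :: rows, l :: ls =>
    if l = 1 then rowCut i (cuts L (i + 1) rows ls) 0 row L else cuts L (i + 1) rows ls
  | _, _, _ => []

end Lisp

/-! ### Running times and specifications of the list functions -/

namespace Lisp

theorem hit_computes (c : ℕ) (row L : List ℕ) (h : row.length ≤ L.length) :
    Computes separatorProgram 0 (.cons (.num c) (.cons (nums row) (nums L))) (.num (hit c row L))
      (50 * (row.length + 1)) := by
  induction row generalizing L with
  | nil =>
    exact ⟨hitBody, rfl, (Ev.iteFalse (.value rfl) (.value rfl)).mono (by simp [Expr.size])⟩
  | cons r row ih =>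
    rcases L with _ | ⟨l, L⟩
    · simp at h
    have ih := ih L (by simpa using h)
    refine ⟨hitBody, rfl, ?_⟩
    simp only [List.length_cons]
    by_cases hr : r = 0
    · subst hr
      rw [show hit c (0 :: row) (l :: L) = hit c row L by simp [hit]]
      exact (Ev.iteTrue (.value rfl) (by simp [nums, Val.ofList])
        (.iteFalse (.iteFalse (.value rfl) (.value rfl)) (.call (.value rfl) ih))).mono
        (by simp [Expr.size]; omega)
    · by_cases hl : l = c
      · rw [show hit c (r :: row) (l :: L) = 1 by simp [hit, hr, hl]]
        exact (Ev.iteTrue (.value rfl) (by simp [nums, Val.ofList])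
          (.iteTrue (.iteTrue (u := .num r) (.value rfl) (by simpa using hr) (.value rfl))
            (by simp [hl]) (.value rfl))).mono
          (by simp [Expr.size]; omega)
      · rw [show hit c (r :: row) (l :: L) = hit c row L by simp [hit, hl]]
        exact (Ev.iteTrue (.value rfl) (by simp [nums, Val.ofList])
          (.iteFalse (.iteTrue (u := .num r) (.value rfl) (by simpa using hr)
            (.eqFalse (m := l) (n := c) (.value rfl) (.value rfl) hl))
            (.call (.value rfl) ih))).mono
          (by simp [Expr.size]; omega)

theorem find_computes (c : ℕ) (L : List ℕ) (i : ℕ) (rows : List (List ℕ)) (ls : List ℕ)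
    (h : rows.length ≤ ls.length) (hrows : ∀ row ∈ rows, row.length ≤ L.length) :
    Computes separatorProgram 1 (.cons (.num c) (.cons (nums L) (.cons (.num i)
      (.cons (matrix rows) (nums ls))))) (.num (find c L i rows ls))
      ((rows.length + 1) * (200 * (L.length + 1))) := by
  induction rows generalizing i ls with
  | nil =>
    exact ⟨findBody, rfl, (Ev.iteFalse (.value rfl) (.value rfl)).mono (by simp [Expr.size]; omega)⟩
  | cons row rows ih =>
    rcases ls with _ | ⟨l, ls⟩
    · simp at h
    have ih := ih (i + 1) ls (by simpa using h) fun r hr => hrows r (by simp [hr])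
    have hlen : row.length ≤ L.length := hrows row (by simp)
    have hit1 := hit_computes 1 row L hlen
    have hitc := hit_computes c row L hlen
    simp only [List.length_cons, add_mul (rows.length + 1) 1, one_mul]
    -- With the cost of the remaining rows as an atom, the estimates become linear.
    generalize hT : (rows.length + 1) * (200 * (L.length + 1)) = T at ih ⊢
    have next : Ev separatorProgram [.cons (.num c) (.cons (nums L) (.cons (.num i)
      (.cons (matrix (row :: rows)) (nums (l :: ls)))))] findNext
        (.num (find c L (i + 1) rows ls)) (T + 50) :=
      (Ev.call (.value rfl) ih).mono (by simp [Expr.size]; omega)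
    refine ⟨findBody, rfl, ?_⟩
    by_cases hl : l = 0
    · subst hl
      by_cases h1 : hit 1 row L = 0
      · rw [show find c L i (row :: rows) (0 :: ls) = find c L (i + 1) rows ls by simp [find, h1]]
        rw [h1] at hit1
        exact (Ev.iteTrue (.value rfl) (by simp [matrix, Val.ofList])
          (.iteFalse (.value rfl) (.iteFalse (.call (.value rfl) hit1) next))).mono
          (by simp [Expr.size]; omega)
      · by_cases hc : hit c row L = 0
        · rw [show find c L i (row :: rows) (0 :: ls) = find c L (i + 1) rows ls by simp [find, hc]]
          rw [hc] at hitc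
          exact (Ev.iteTrue (.value rfl) (by simp [matrix, Val.ofList])
            (.iteFalse (.value rfl) (.iteTrue (.call (.value rfl) hit1) (by simpa using h1)
              (.iteFalse (.call (.value rfl) hitc) next)))).mono
            (by simp [Expr.size]; omega)
        · rw [show find c L i (row :: rows) (0 :: ls) = i + 1 by simp [find, h1, hc]]
          exact (Ev.iteTrue (.value rfl) (by simp [matrix, Val.ofList])
            (.iteFalse (.value rfl) (.iteTrue (.call (.value rfl) hit1) (by simpa using h1)
              (.iteTrue (.call (.value rfl) hitc) (by simpa using hc) (.value rfl))))).mono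
            (by simp [Expr.size]; omega)
    · rw [show find c L i (row :: rows) (l :: ls) = find c L (i + 1) rows ls by simp [find, hl]]
      exact (Ev.iteTrue (.value rfl) (by simp [matrix, Val.ofList])
        (.iteTrue (u := .num l) (.value rfl) (by simpa using hl) next)).mono
        (by simp [Expr.size]; omega)

theorem set_computes (i c : ℕ) (L : List ℕ) :
    Computes separatorProgram 2 (.cons (.num i) (.cons (.num c) (nums L))) (nums (L.set i c))
      (50 * (L.length + 1)) := by
  induction L generalizing i with
  | nil =>
    exact ⟨setBody, rfl, (Ev.iteFalse (.value rfl) (.value rfl)).mono (by simp [Expr.size])⟩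
  | cons l L ih =>
    refine ⟨setBody, rfl, ?_⟩
    simp only [List.length_cons]
    rcases i with _ | i
    · exact (Ev.iteTrue (.value rfl) (by simp [nums, Val.ofList])
        (.iteFalse (.value rfl) (.value rfl))).mono (by simp [Expr.size]; omega)
    · exact (Ev.iteTrue (.value rfl) (by simp [nums, Val.ofList])
        (.iteTrue (u := .num (i + 1)) (.value rfl) (by simp)
          (.cons (.value rfl) (.call (.value rfl) (ih i))))).mono (by simp [Expr.size]; omega)

theorem dels_computes (i : ℕ) (L : List ℕ) :
    Computes separatorProgram 3 (.cons (.num i) (nums L)) (nums (dels i L))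
      (50 * (L.length + 1)) := by
  induction L generalizing i with
  | nil =>
    exact ⟨delsBody, rfl, (Ev.iteFalse (.value rfl) (.value rfl)).mono (by simp [Expr.size])⟩
  | cons l L ih =>
    refine ⟨delsBody, rfl, ?_⟩
    simp only [List.length_cons]
    by_cases hl : l = 3
    · rw [show dels i (l :: L) = i :: dels (i + 1) L by simp [dels, hl]]
      exact (Ev.iteTrue (.value rfl) (by simp [nums, Val.ofList])
        (.letE (.call (.value rfl) (ih (i + 1)))
          (.iteTrue (.eqTrue (m := l) (n := 3) (.value rfl) (.value rfl) hl) (by simp)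
            (.value rfl)))).mono (by simp [Expr.size]; omega)
    · rw [show dels i (l :: L) = dels (i + 1) L by simp [dels, hl]]
      exact (Ev.iteTrue (.value rfl) (by simp [nums, Val.ofList])
        (.letE (.call (.value rfl) (ih (i + 1)))
          (.iteFalse (.eqFalse (m := l) (n := 3) (.value rfl) (.value rfl) hl)
            (.value rfl)))).mono (by simp [Expr.size]; omega)

theorem rowCut_computes (i : ℕ) (acc : List (ℕ × ℕ)) (j : ℕ) (row L : List ℕ)
    (h : row.length ≤ L.length) :
    Computes separatorProgram 4 (.cons (.num i) (.cons (.num j) (.cons (pairs acc)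
      (.cons (nums row) (nums L))))) (pairs (rowCut i acc j row L)) (100 * (row.length + 1)) := by
  induction row generalizing j L with
  | nil =>
    exact ⟨rowCutBody, rfl, (Ev.iteFalse (.value rfl) (.value rfl)).mono (by simp [Expr.size])⟩
  | cons r row ih =>
    rcases L with _ | ⟨l, L⟩
    · simp at h
    have ih := ih (j + 1) L (by simpa using h)
    refine ⟨rowCutBody, rfl, ?_⟩
    simp only [List.length_cons]
    refine (Ev.iteTrue (.value rfl) (by simp [nums, Val.ofList])
      (T₂ := 80 + 100 * (row.length + 1)) ?_).mono (by simp [Expr.size]; omega)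
    refine (Ev.letE (.call (.value rfl) ih) (T₂ := 40) ?_).mono (by simp [Expr.size]; omega)
    by_cases hr : r = 0
    · subst hr
      rw [show rowCut i acc j (0 :: row) (l :: L) = rowCut i acc (j + 1) row L by simp [rowCut]]
      exact (Ev.iteFalse (.iteFalse (.value rfl) (.value rfl)) (.value rfl)).mono
        (by simp [Expr.size])
    · by_cases hl : l = 2
      · rw [show rowCut i acc j (r :: row) (l :: L) = (i, j) :: rowCut i acc (j + 1) row L by
          simp [rowCut, hr, hl]]
        exact (Ev.iteTrue (.iteTrue (u := .num r) (.value rfl) (by simpa using hr)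
          (.eqTrue (m := l) (n := 2) (.value rfl) (.value rfl) hl)) (by simp) (.value rfl)).mono
          (by simp [Expr.size])
      · rw [show rowCut i acc j (r :: row) (l :: L) = rowCut i acc (j + 1) row L by
          simp [rowCut, hl]]
        exact (Ev.iteFalse (.iteTrue (u := .num r) (.value rfl) (by simpa using hr)
          (.eqFalse (m := l) (n := 2) (.value rfl) (.value rfl) hl)) (.value rfl)).mono
          (by simp [Expr.size])

theorem cuts_computes (L : List ℕ) (i : ℕ) (rows : List (List ℕ)) (ls : List ℕ)
    (h : rows.length ≤ ls.length) (hrows : ∀ row ∈ rows, row.length ≤ L.length) :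
    Computes separatorProgram 5 (.cons (.num i) (.cons (nums L) (.cons (matrix rows) (nums ls))))
      (pairs (cuts L i rows ls)) ((rows.length + 1) * (200 * (L.length + 1))) := by
  induction rows generalizing i ls with
  | nil =>
    exact ⟨cutsBody, rfl, (Ev.iteFalse (.value rfl) (.value rfl)).mono (by simp [Expr.size]; omega)⟩
  | cons row rows ih =>
    rcases ls with _ | ⟨l, ls⟩
    · simp at h
    have ih := ih (i + 1) ls (by simpa using h) fun r hr => hrows r (by simp [hr])
    have hlen : row.length ≤ L.length := hrows row (by simp)
    simp only [List.length_cons, add_mul (rows.length + 1) 1, one_mul]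
    generalize hT : (rows.length + 1) * (200 * (L.length + 1)) = T at ih ⊢
    refine ⟨cutsBody, rfl, ?_⟩
    by_cases hl : l = 1
    · rw [show cuts L i (row :: rows) (l :: ls) = rowCut i (cuts L (i + 1) rows ls) 0 row L by
        simp [cuts, hl]]
      exact (Ev.iteTrue (.value rfl) (by simp [matrix, Val.ofList])
        (.letE (.call (.value rfl) ih)
          (.iteTrue (.eqTrue (m := l) (n := 1) (.value rfl) (.value rfl) hl) (by simp)
            (.call (.value rfl) (rowCut_computes i (cuts L (i + 1) rows ls) 0 row L hlen))))).mono
        (by simp [Expr.size]; omega)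
    · rw [show cuts L i (row :: rows) (l :: ls) = cuts L (i + 1) rows ls by simp [cuts, hl]]
      exact (Ev.iteTrue (.value rfl) (by simp [matrix, Val.ofList])
        (.letE (.call (.value rfl) ih)
          (.iteFalse (.eqFalse (m := l) (n := 1) (.value rfl) (.value rfl) hl)
            (.value rfl)))).mono
        (by simp [Expr.size]; omega)

theorem length_computes (l : List Val) :
    Computes separatorProgram 6 (.ofList l) (.num l.length) (10 * (l.length + 1)) := by
  induction l with
  | nil =>
    exact ⟨lengthBody, rfl, (Ev.iteFalse (.value rfl) (.value rfl)).mono (by simp [Expr.size])⟩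
  | cons v l ih =>
    refine ⟨lengthBody, rfl, ?_⟩
    simp only [List.length_cons]
    exact (Ev.iteTrue (.value rfl) (by simp [Val.ofList]) (.succ (.call (.value rfl) ih))).mono
      (by simp [Expr.size]; omega)

theorem zeros_computes (l : List Val) :
    Computes separatorProgram 7 (.ofList l) (nums (List.replicate l.length 0))
      (10 * (l.length + 1)) := by
  induction l with
  | nil =>
    exact ⟨zerosBody, rfl, (Ev.iteFalse (.value rfl) (.value rfl)).mono (by simp [Expr.size])⟩
  | cons v l ih =>
    refine ⟨zerosBody, rfl, ?_⟩
    simp only [List.length_cons]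
    exact (Ev.iteTrue (.value rfl) (by simp [Val.ofList])
      (.cons (.value rfl) (.call (.value rfl) ih))).mono (by simp [Expr.size]; omega)

theorem nth_computes (i : ℕ) (L : List ℕ) (h : i < L.length) :
    Computes separatorProgram 8 (.cons (.num i) (nums L)) (.num L[i]) (20 * (i + 1)) := by
  induction i generalizing L with
  | zero =>
    rcases L with _ | ⟨l, L⟩
    · simp at h
    exact ⟨nthBody, rfl, (Ev.iteFalse (.value rfl) (.value rfl)).mono (by simp [Expr.size])⟩
  | succ i ih =>
    rcases L with _ | ⟨l, L⟩
    · simp at h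
    refine ⟨nthBody, rfl, ?_⟩
    exact (Ev.iteTrue (u := .num (i + 1)) (.value rfl) (by simp)
      (.call (.value rfl) (ih L (by simpa using h)))).mono (by simp [Expr.size]; omega)

/-! ### What the auxiliary functions compute -/

theorem hit_ne_zero_iff {c : ℕ} {row L : List ℕ} :
    hit c row L ≠ 0 ↔ ∃ (j r : ℕ), row[j]? = some r ∧ r ≠ 0 ∧ L[j]? = some c := by
  induction row generalizing L with
  | nil => simp [hit]
  | cons r row ih =>
    rcases L with _ | ⟨l, L⟩
    · simp [hit]
    rw [← Nat.or_exists_add_one]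
    simp only [List.getElem?_cons_zero, List.getElem?_cons_succ, ← ih]
    by_cases h : r ≠ 0 ∧ l = c
    · simp [hit, h]
    · simp only [hit, h, if_false]
      constructor
      · exact Or.inr
      · rintro (⟨r', hr', hne, hl⟩ | h')
        · simp only [Option.some.injEq] at hr' hl
          exact absurd ⟨hr' ▸ hne, hl⟩ h
        · exact h'

theorem find_eq_zero {c : ℕ} {L : List ℕ} {i : ℕ} {rows : List (List ℕ)} {ls : List ℕ}
    (h : find c L i rows ls = 0) {j : ℕ} {row : List ℕ} (hrow : rows[j]? = some row)
    (hl : ls[j]? = some 0) : ¬ (hit 1 row L ≠ 0 ∧ hit c row L ≠ 0) := by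
  induction rows generalizing i ls j with
  | nil => simp at hrow
  | cons r rows ih =>
    rcases ls with _ | ⟨l, ls⟩
    · simp at hl
    rw [find] at h
    split at h
    · omega
    · rename_i hn
      rcases j with _ | j
      · simp only [List.getElem?_cons_zero, Option.some.injEq] at hrow hl
        subst hrow hl
        exact fun h' => hn ⟨rfl, h'⟩
      · exact ih h (by simpa using hrow) (by simpa using hl)

theorem find_ne_zero {c : ℕ} {L : List ℕ} {i : ℕ} {rows : List (List ℕ)} {ls : List ℕ}
    (h : find c L i rows ls ≠ 0) : ∃ j row, find c L i rows ls = i + j + 1 ∧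
      rows[j]? = some row ∧ ls[j]? = some 0 ∧ hit 1 row L ≠ 0 ∧ hit c row L ≠ 0 := by
  induction rows generalizing i ls with
  | nil => simp [find] at h
  | cons r rows ih =>
    rcases ls with _ | ⟨l, ls⟩
    · simp [find] at h
    rw [find] at h ⊢
    split
    · rename_i hc
      exact ⟨0, r, by simp, by simp, by simp [hc.1], hc.2⟩
    · rename_i hn
      rw [if_neg hn] at h
      obtain ⟨j, row, h1, h2, h3, h4⟩ := ih h
      exact ⟨j + 1, row, by omega, by simpa using h2, by simpa using h3, h4⟩

theorem mem_dels {i : ℕ} {L : List ℕ} {p : ℕ} : p ∈ dels i L ↔ ∃ j, p = i + j ∧ L[j]? = some 3 := by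
  induction L generalizing i with
  | nil => simp [dels]
  | cons l L ih =>
    rw [← Nat.or_exists_add_one]
    have : (∃ j, p = i + (j + 1) ∧ (l :: L)[j + 1]? = some 3) ↔ p ∈ dels (i + 1) L := by
      rw [ih]
      simp [add_assoc, add_comm 1]
    rw [this]
    by_cases hl : l = 3 <;> simp [dels, hl]

theorem nodup_dels (i : ℕ) (L : List ℕ) : (dels i L).Nodup := by
  induction L generalizing i with
  | nil => simp [dels]
  | cons l L ih =>
    by_cases hl : l = 3
    · simp only [dels, hl, if_true, List.nodup_cons]
      refine ⟨fun h => ?_, ih _⟩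
      obtain ⟨j, hj, -⟩ := mem_dels.mp h
      omega
    · simpa [dels, hl] using ih (i + 1)

theorem mem_rowCut {i : ℕ} {acc : List (ℕ × ℕ)} {j : ℕ} {row L : List ℕ} {p : ℕ × ℕ} :
    p ∈ rowCut i acc j row L ↔ p ∈ acc ∨ ∃ k r, p = (i, j + k) ∧ row[k]? = some r ∧ r ≠ 0 ∧
      L[k]? = some 2 := by
  induction row generalizing j L with
  | nil => simp [rowCut]
  | cons r row ih =>
    rcases L with _ | ⟨l, L⟩
    · simp [rowCut]
    rw [← Nat.or_exists_add_one]
    have : (∃ k r', p = (i, j + (k + 1)) ∧ (r :: row)[k + 1]? = some r' ∧ r' ≠ 0 ∧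
        (l :: L)[k + 1]? = some 2) ↔ ∃ k r', p = (i, j + 1 + k) ∧ row[k]? = some r' ∧ r' ≠ 0 ∧
        L[k]? = some 2 := by
      simp [add_assoc, add_comm 1]
    rw [this, or_left_comm, ← ih]
    by_cases h : r ≠ 0 ∧ l = 2
    · simp [rowCut, h]
    · simp only [rowCut, h, if_false]
      constructor
      · exact Or.inr
      · rintro (⟨r', -, hr', hne, hl⟩ | h')
        · simp only [List.getElem?_cons_zero, Option.some.injEq] at hr' hl
          exact absurd ⟨hr' ▸ hne, hl⟩ h
        · exact h'

/-- In `cuts` the accumulator holds the pairs of later rows, whose first coordinates exceed `i`. -/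
theorem nodup_rowCut {i : ℕ} {acc : List (ℕ × ℕ)} (hacc : acc.Nodup) (hi : ∀ p ∈ acc, p.1 ≠ i)
    (j : ℕ) (row L : List ℕ) : (rowCut i acc j row L).Nodup := by
  induction row generalizing j L with
  | nil => simpa [rowCut] using hacc
  | cons r row ih =>
    rcases L with _ | ⟨l, L⟩
    · simpa [rowCut] using hacc
    by_cases h : r ≠ 0 ∧ l = 2
    · simp only [rowCut, h, ne_eq, not_false_eq_true, and_self, if_true, List.nodup_cons]
      refine ⟨fun h' => ?_, ih _ _⟩
      rcases mem_rowCut.mp h' with h' | ⟨k, r', h', -⟩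
      · exact hi _ h' rfl
      · simp only [Prod.mk.injEq, true_and] at h'
        omega
    · simpa [rowCut, h] using ih (j + 1) L

theorem mem_cuts {L : List ℕ} {i : ℕ} {rows : List (List ℕ)} {ls : List ℕ} {p : ℕ × ℕ} :
    p ∈ cuts L i rows ls ↔ ∃ k row r, p.1 = i + k ∧ rows[k]? = some row ∧ ls[k]? = some 1 ∧
      row[p.2]? = some r ∧ r ≠ 0 ∧ L[p.2]? = some 2 := by
  induction rows generalizing i ls with
  | nil => simp [cuts]
  | cons row rows ih =>
    rcases ls with _ | ⟨l, ls⟩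
    · simp [cuts]
    rw [← Nat.or_exists_add_one]
    have : (∃ k row' r, p.1 = i + (k + 1) ∧ (row :: rows)[k + 1]? = some row' ∧
        (l :: ls)[k + 1]? = some 1 ∧ row'[p.2]? = some r ∧ r ≠ 0 ∧ L[p.2]? = some 2) ↔
        p ∈ cuts L (i + 1) rows ls := by
      rw [ih]
      simp [add_assoc, add_comm 1]
    rw [this]
    by_cases hl : l = 1
    · simp only [cuts, hl, if_true, mem_rowCut, List.getElem?_cons_zero, add_zero]
      rw [or_comm]
      refine or_congr ?_ Iff.rfl
      constructor
      · rintro ⟨k, r, rfl, h⟩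
        simp only [zero_add]
        exact ⟨row, r, by simp, by simp, by simp, h⟩
      · rintro ⟨row', r, h1, h2, -, h⟩
        obtain rfl := Option.some.inj h2
        exact ⟨p.2, r, by simp [← h1], h⟩
    · simp [cuts, hl]

theorem nodup_cuts (L : List ℕ) (i : ℕ) (rows : List (List ℕ)) (ls : List ℕ) :
    (cuts L i rows ls).Nodup := by
  induction rows generalizing i ls with
  | nil => simp [cuts]
  | cons row rows ih =>
    rcases ls with _ | ⟨l, ls⟩
    · simp [cuts]
    by_cases hl : l = 1
    · simp only [cuts, hl, if_true]
      refine nodup_rowCut (ih _ _) (fun p hp => ?_) _ _ _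
      obtain ⟨k, -, -, h, -⟩ := mem_cuts.mp hp
      omega
    · simpa [cuts, hl] using ih (i + 1) ls

end Lisp

namespace Lisp

open SimpleGraph

/-! ### Labelings as lists -/

section Encoding

variable {k : ℕ} {F : SimpleGraph (Fin k)} {lam : Fin k → ℕ}

/-- The adjacency matrix. -/
noncomputable def adjRows (F : SimpleGraph (Fin k)) : List (List ℕ) :=
  List.ofFn fun i => List.ofFn fun j => bit01 (F.Adj i j)

theorem encodeGraph_eq (F : SimpleGraph (Fin k)) : encodeGraph F = matrix (adjRows F) := by
  simp only [encodeGraph, matrix, adjRows, List.map_ofFn]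
  congr 2
  funext i
  simp only [Function.comp_apply, nums, List.map_ofFn]
  rfl

theorem length_adjRows (F : SimpleGraph (Fin k)) : (adjRows F).length = k := by
  simp [adjRows]

theorem length_of_mem_adjRows {row : List ℕ} (h : row ∈ adjRows F) : row.length = k := by
  obtain ⟨i, rfl⟩ := (List.mem_ofFn' _ _).mp h
  simp

theorem getElem?_ofFn_eq_some {α : Type*} {f : Fin k → α} {j : ℕ} {c : α} :
    (List.ofFn f)[j]? = some c ↔ ∃ h : j < k, f ⟨j, h⟩ = c := by
  rw [List.getElem?_ofFn]
  split
  · rename_i h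
    simp [h]
  · rename_i h
    simp [h]

theorem hit_adj_ne_zero_iff {c : ℕ} {i : Fin k} :
    hit c (List.ofFn fun j => bit01 (F.Adj i j)) (List.ofFn lam) ≠ 0 ↔
      ∃ j, F.Adj i j ∧ lam j = c := by
  rw [hit_ne_zero_iff]
  constructor
  · rintro ⟨j, r, h1, h2, h3⟩
    obtain ⟨hj, rfl⟩ := getElem?_ofFn_eq_some.mp h1
    obtain ⟨hj, h3⟩ := getElem?_ofFn_eq_some.mp h3
    refine ⟨⟨j, hj⟩, ?_, h3⟩
    by_contra hn
    simp [bit01, hn] at h2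
  · rintro ⟨j, h1, h2⟩
    exact ⟨j, 1, getElem?_ofFn_eq_some.mpr ⟨j.2, by simp [bit01, h1]⟩, by simp,
      getElem?_ofFn_eq_some.mpr ⟨j.2, h2⟩⟩

theorem not_isContact_of_find {c : ℕ}
    (h : find c (List.ofFn lam) 0 (adjRows F) (List.ofFn lam) = 0) (w : Fin k) :
    ¬ F.IsContact lam c w := by
  rintro ⟨hw, h1, h2⟩
  exact find_eq_zero h (j := w) (getElem?_ofFn_eq_some.mpr ⟨w.2, rfl⟩)
    (getElem?_ofFn_eq_some.mpr ⟨w.2, hw⟩) ⟨hit_adj_ne_zero_iff.mpr h1, hit_adj_ne_zero_iff.mpr h2⟩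

theorem exists_isContact_of_find {c : ℕ}
    (h : find c (List.ofFn lam) 0 (adjRows F) (List.ofFn lam) ≠ 0) :
    ∃ w : Fin k, find c (List.ofFn lam) 0 (adjRows F) (List.ofFn lam) = w + 1 ∧
      F.IsContact lam c w := by
  obtain ⟨j, row, h1, h2, h3, h4, h5⟩ := find_ne_zero h
  obtain ⟨hj, rfl⟩ := getElem?_ofFn_eq_some.mp h2
  obtain ⟨_, hj0⟩ := getElem?_ofFn_eq_some.mp h3
  exact ⟨⟨j, hj⟩, by simpa using h1, hj0, hit_adj_ne_zero_iff.mp h4, hit_adj_ne_zero_iff.mp h5⟩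

theorem set_ofFn (lam : Fin k → ℕ) (w : Fin k) (c : ℕ) :
    (List.ofFn lam).set w c = List.ofFn (Function.update lam w c) := by
  refine List.ext_getElem (by simp) fun i h1 h2 => ?_
  rw [List.getElem_set, List.getElem_ofFn, List.getElem_ofFn]
  split
  · rename_i h
    subst h
    simp
  · rename_i h
    rw [Function.update_of_ne]
    intro h'
    exact h (by rw [← h'])

/-- The program outputs bare numbers; all are below `k`, so they lift to the list of vertices that
`RepresentsPair` requires. -/
theorem exists_dels (lam : Fin k → ℕ) : ∃ l : List (Fin k), l.Nodup ∧
    l.toFinset = labelVertices lam ∧ dels 0 (List.ofFn lam) = l.map (↑) := by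
  have hlt : ∀ p ∈ dels 0 (List.ofFn lam), p < k := by
    intro p hp
    obtain ⟨j, rfl, hj⟩ := mem_dels.mp hp
    obtain ⟨h, -⟩ := getElem?_ofFn_eq_some.mp hj
    omega
  obtain ⟨l, hl⟩ : ∃ l : List (Fin k), l.map (↑) = dels 0 (List.ofFn lam) := by
    refine ⟨(dels 0 (List.ofFn lam)).pmap (fun p hp => ⟨p, hp⟩) hlt, ?_⟩
    simp [List.map_pmap]
  refine ⟨l, List.Nodup.of_map _ (hl ▸ nodup_dels 0 _), ?_, hl.symm⟩
  ext p
  have hmem : p ∈ l ↔ (p : ℕ) ∈ dels 0 (List.ofFn lam) := by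
    rw [← hl, List.mem_map_of_injective Fin.val_injective]
  rw [List.mem_toFinset, hmem, mem_dels]
  simp only [zero_add, labelVertices, Finset.mem_filter, Finset.mem_univ, true_and]
  constructor
  · rintro ⟨j, hj, h⟩
    obtain ⟨_, h⟩ := getElem?_ofFn_eq_some.mp h
    simpa [← hj] using h
  · intro h
    exact ⟨p, rfl, getElem?_ofFn_eq_some.mpr ⟨p.2, h⟩⟩

theorem mem_cuts_adjRows {p : ℕ × ℕ} :
    p ∈ cuts (List.ofFn lam) 0 (adjRows F) (List.ofFn lam) ↔
      ∃ i j : Fin k, p = (↑i, ↑j) ∧ F.Adj i j ∧ lam i = 1 ∧ lam j = 2 := by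
  rw [mem_cuts]
  constructor
  · rintro ⟨i, row, r, h0, h1, h2, h3, h4, h5⟩
    obtain ⟨hi, rfl⟩ := getElem?_ofFn_eq_some.mp h1
    obtain ⟨_, hi1⟩ := getElem?_ofFn_eq_some.mp h2
    obtain ⟨hj, rfl⟩ := getElem?_ofFn_eq_some.mp h3
    obtain ⟨_, hj2⟩ := getElem?_ofFn_eq_some.mp h5
    refine ⟨⟨i, hi⟩, ⟨p.2, hj⟩, Prod.ext (by simpa using h0) rfl, ?_, hi1, hj2⟩
    by_contra hn
    simp [bit01, hn] at h4
  · rintro ⟨i, j, rfl, hij, h1, h2⟩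
    exact ⟨i, List.ofFn fun j => bit01 (F.Adj i j), 1, by simp,
      getElem?_ofFn_eq_some.mpr ⟨i.2, rfl⟩, getElem?_ofFn_eq_some.mpr ⟨i.2, h1⟩,
      getElem?_ofFn_eq_some.mpr ⟨j.2, by simp [bit01, hij]⟩, by simp,
      getElem?_ofFn_eq_some.mpr ⟨j.2, h2⟩⟩

theorem exists_cuts (F : SimpleGraph (Fin k)) (lam : Fin k → ℕ) :
    ∃ m : List (Fin k × Fin k), m.Nodup ∧ m.toFinset = F.labelEdges lam ∧
      cuts (List.ofFn lam) 0 (adjRows F) (List.ofFn lam) = m.map fun p => (↑p.1, ↑p.2) := by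
  have hlt : ∀ p ∈ cuts (List.ofFn lam) 0 (adjRows F) (List.ofFn lam), p.1 < k ∧ p.2 < k := by
    intro p hp
    obtain ⟨i, j, rfl, -⟩ := mem_cuts_adjRows.mp hp
    exact ⟨i.2, j.2⟩
  have hinj : Function.Injective fun p : Fin k × Fin k => ((p.1 : ℕ), (p.2 : ℕ)) := by
    rintro ⟨i, j⟩ ⟨i', j'⟩ h
    simpa [Fin.ext_iff] using h
  obtain ⟨m, hm⟩ : ∃ m : List (Fin k × Fin k), (m.map fun p => ((p.1 : ℕ), (p.2 : ℕ))) =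
      cuts (List.ofFn lam) 0 (adjRows F) (List.ofFn lam) := by
    refine ⟨(cuts (List.ofFn lam) 0 (adjRows F) (List.ofFn lam)).pmap
      (fun p hp => (⟨p.1, hp.1⟩, ⟨p.2, hp.2⟩)) hlt, ?_⟩
    simp [List.map_pmap]
  refine ⟨m, List.Nodup.of_map _ (hm ▸ nodup_cuts _ _ _ _), ?_, hm.symm⟩
  ext ⟨i, j⟩
  have hmem : (i, j) ∈ m ↔ ((i : ℕ), (j : ℕ)) ∈
      cuts (List.ofFn lam) 0 (adjRows F) (List.ofFn lam) := by
    rw [← hm, ← List.mem_map_of_injective hinj]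
  rw [List.mem_toFinset, hmem, mem_cuts_adjRows]
  simp only [labelEdges, Finset.mem_filter, Finset.mem_univ, true_and]
  constructor
  · rintro ⟨i', j', h, h'⟩
    simp only [Prod.mk.injEq, Fin.val_inj] at h
    rwa [h.1, h.2]
  · intro h
    exact ⟨i, j, rfl, h⟩

theorem representsPair_of_labels {l : List (Fin k)} {m : List (Fin k × Fin k)} (hl : l.Nodup)
    (hl' : l.toFinset = labelVertices lam) (hm : m.Nodup)
    (hm' : m.toFinset = F.labelEdges lam) :
    RepresentsPair (.cons (nums (l.map (↑))) (pairs (m.map fun p => (↑p.1, ↑p.2))))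
      (labelVertices lam) ((F.labelEdges lam).image fun p => s(p.1, p.2)) := by
  refine ⟨l, m, hl, hl', hm.map_on ?_, ?_, ?_⟩
  · intro p hp q hq h
    have hp' : F.Adj p.1 p.2 ∧ lam p.1 = 1 ∧ lam p.2 = 2 := by
      simpa [hm', labelEdges] using List.mem_toFinset.mpr hp
    have hq' : F.Adj q.1 q.2 ∧ lam q.1 = 1 ∧ lam q.2 = 2 := by
      simpa [hm', labelEdges] using List.mem_toFinset.mpr hq
    -- Reversed pairs are impossible, as the first entry has label `1` and the second label `2`.
    rcases Sym2.eq_iff.mp h with h | h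
    · exact Prod.ext h.1 h.2
    · have := hp'.2.1
      rw [h.1] at this
      omega
  · rw [← hm']
    ext e
    simp
  · simp [nums, pairs, Function.comp_def, ← List.map_eq_flatMap]

end Encoding

/-! ### The search -/

section Search

variable {inp C D v₁ v₂ v₃ : Val} {L : List ℕ} {w T : ℕ}

/-- The three recursive calls enter as hypotheses. The last clause makes failure of the branching
imply failure of every branch, which is what completeness needs. -/
theorem branchBody_ev (h₃ : Computes separatorProgram 9 (.cons inp (nums (L.set w 3))) v₃ T)
    (h₁ : Computes separatorProgram 9 (.cons inp (nums (L.set w 1))) v₁ T)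
    (h₂ : Computes separatorProgram 9 (.cons inp (nums (L.set w 2))) v₂ T) :
    ∃ v, Ev separatorProgram [.num (w + 1), C, D, .cons inp (nums L)] branchBody v
        (3 * T + 150 * (L.length + 1) + 200) ∧ (v = v₃ ∨ v = v₁ ∨ v = v₂) ∧
      (v = answerNo → v₃ = answerNo ∧ v₁ = answerNo ∧ v₂ = answerNo) := by
  by_cases h3 : v₃ = .num 0
  · subst h3
    by_cases h1 : v₁ = .num 0
    · subst h1
      refine ⟨v₂, (Ev.letE (.call (.cons (.value rfl)
        (.call (.value rfl) (set_computes w 3 L))) h₃) (.iteFalse (.value rfl)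
        (.letE (.call (.cons (.value rfl) (.call (.value rfl) (set_computes w 1 L))) h₁)
          (.iteFalse (.value rfl)
            (.call (.cons (.value rfl) (.call (.value rfl) (set_computes w 2 L))) h₂))))).mono ?_,
        by simp, fun h => ⟨rfl, rfl, h⟩⟩
      simp [Expr.size]
      omega
    · refine ⟨v₁, (Ev.letE (.call (.cons (.value rfl)
        (.call (.value rfl) (set_computes w 3 L))) h₃) (.iteFalse (.value rfl)
        (.letE (.call (.cons (.value rfl) (.call (.value rfl) (set_computes w 1 L))) h₁)
          (.iteTrue (.value rfl) h1 (.value rfl))))).mono ?_,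
        by simp, fun h => absurd h h1⟩
      simp [Expr.size]
      omega
  · refine ⟨v₃, (Ev.letE (.call (.cons (.value rfl)
        (.call (.value rfl) (set_computes w 3 L))) h₃)
          (.iteTrue (.value rfl) h3 (.value rfl))).mono ?_,
        by simp, fun h => absurd h h3⟩
    simp [Expr.size]
    omega

variable {k : ℕ} {F : SimpleGraph (Fin k)} {x y : Fin k} {a b : ℕ} {lam : Fin k → ℕ}

theorem answerBody_ev : Ev separatorProgram
      [.num 0, .num 0, C, D, .cons (encodeInput F x y a b) (nums (List.ofFn lam))] answerBody
      (if lam x = 1 ∧ lam y ≠ 1 ∧ lam y ≠ 3 then .cons D C else answerNo)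
      (40 * (k + 1) + 200) := by
  have hx := nth_computes x (List.ofFn lam) (by simp)
  have hy := nth_computes y (List.ofFn lam) (by simp)
  rw [List.getElem_ofFn] at hx hy
  simp only [Fin.eta] at hx hy
  have hxk := x.2
  have hyk := y.2
  by_cases h1 : lam x = 1
  · by_cases h2 : lam y = 1
    · rw [if_neg (by simp [h2])]
      exact (Ev.iteTrue (.eqTrue (.call (.value rfl) hx) (.value rfl) h1) (by simp)
        (.letE (.call (.value rfl) hy) (.iteTrue (.eqTrue (m := lam y) (n := 1) (.value rfl)
          (.value rfl) h2) (by simp) (.value rfl)))).mono (by simp [Expr.size]; omega)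
    · by_cases h3 : lam y = 3
      · rw [if_neg (by simp [h3])]
        exact (Ev.iteTrue (.eqTrue (.call (.value rfl) hx) (.value rfl) h1) (by simp)
          (.letE (.call (.value rfl) hy) (.iteFalse (.eqFalse (m := lam y) (n := 1) (.value rfl)
            (.value rfl) h2) (.iteTrue (.eqTrue (m := lam y) (n := 3) (.value rfl)
              (.value rfl) h3) (by simp) (.value rfl))))).mono (by simp [Expr.size]; omega)
      · rw [if_pos ⟨h1, h2, h3⟩]
        exact (Ev.iteTrue (.eqTrue (.call (.value rfl) hx) (.value rfl) h1) (by simp)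
          (.letE (.call (.value rfl) hy) (.iteFalse (.eqFalse (m := lam y) (n := 1) (.value rfl)
            (.value rfl) h2) (.iteFalse (.eqFalse (m := lam y) (n := 3) (.value rfl)
              (.value rfl) h3) (.value rfl))))).mono (by simp [Expr.size]; omega)
  · rw [if_neg (by simp [h1])]
    exact (Ev.iteFalse (.eqFalse (.call (.value rfl) hx) (.value rfl) h1) (.value rfl)).mono
      (by simp [Expr.size]; omega)

/-- A value that represents a separator within the budgets. -/
def IsAnswer (F : SimpleGraph (Fin k)) (x y : Fin k) (a b : ℕ) (v : Val) : Prop :=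
  ∃ (VS : Finset (Fin k)) (ES : Finset (Sym2 (Fin k))),
    F.IsMixedSeparatorOfSizeAtMost x y a b VS ES ∧ RepresentsPair v VS ES

/-- The number of unassigned vertices decreases. -/
theorem card_free_update {c f : ℕ} {w : Fin k} (hw : lam w = 0) (hc : c ≠ 0)
    (hf : (Finset.univ.filter fun p => lam p = 0).card ≤ f + 1) :
    (Finset.univ.filter fun p => Function.update lam w c p = 0).card ≤ f := by
  refine Nat.le_of_lt_succ (lt_of_lt_of_le (Finset.card_lt_card ?_) hf)
  refine Finset.ssubset_iff.mpr ⟨w, by simp [hc], fun p hp => ?_⟩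
  by_cases hpw : p = w
  · simp [hpw, hw]
  · simpa [hpw] using hp

theorem update_le_three {c : ℕ} (hc : c ≤ 3) (hle : ∀ p, lam p ≤ 3) (w p : Fin k) :
    Function.update lam w c p ≤ 3 := by
  by_cases hpw : p = w
  · simpa [hpw] using hc
  · simpa [hpw] using hle p

/-- The number of steps of one call of the search without the recursive calls. -/
def localCost (k : ℕ) : ℕ := 2000 * ((k + 1) * (k + 1))

/-- The search below a labeling is sound, succeeds from every labeling with the invariant, and
has a bounded number of branches. -/
theorem search_computes (F : SimpleGraph (Fin k)) (x y : Fin k) (a b f : ℕ) (lam : Fin k → ℕ)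
    (hfree : (Finset.univ.filter fun p => lam p = 0).card ≤ f) (hle : ∀ p, lam p ≤ 3) (m : ℕ)
    (hm : a + b + 1 ≤ m + (labelVertices lam).card + (F.labelEdges lam).card) :
    ∃ v, Computes separatorProgram 9 (.cons (encodeInput F x y a b) (nums (List.ofFn lam))) v
        (3 ^ m * ((f + 1) * localCost k)) ∧ (v = answerNo ∨ IsAnswer F x y a b v) ∧
      ∀ Good, F.IsSearchInvariant x y a b Good → Good lam → v ≠ answerNo := by
  -- Every recursive call assigns a vertex, so `f` drops. A branching also raises the number of
  -- deleted vertices or cut edges, so `m` may drop by one; absorption keeps `m`.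
  induction f using Nat.strong_induction_on generalizing lam m with
  | _ f ih =>
  obtain ⟨l, hl, hl', hld⟩ := exists_dels lam
  obtain ⟨e, he, he', hec⟩ := exists_cuts F lam
  have hlcard : l.length = (labelVertices lam).card := by rw [← hl', List.toFinset_card_of_nodup hl]
  have hecard : e.length = (F.labelEdges lam).card := by rw [← he', List.toFinset_card_of_nodup he]
  have hrows : ∀ row ∈ adjRows F, row.length ≤ (List.ofFn lam).length := fun row hrow => by
    simp [length_of_mem_adjRows hrow]
  have hM : k + 1 ≤ (k + 1) * (k + 1) := Nat.le_mul_self _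
  have hq : localCost k = 2000 * ((k + 1) * (k + 1)) := rfl
  have hl6 : Computes separatorProgram 6 (nums (l.map (↑))) (.num l.length) (10 * (k + 1)) := by
    have h := length_computes ((l.map (fun p : Fin k => (p : ℕ))).map Val.num)
    simp only [List.length_map] at h
    refine h.mono ?_
    have := hl.length_le_card
    simp only [Fintype.card_fin] at this
    omega
  have he6 : Computes separatorProgram 6 (pairs (e.map fun p => (↑p.1, ↑p.2))) (.num e.length)
      (10 * ((k + 1) * (k + 1))) := by
    have h := length_computes ((e.map fun p : Fin k × Fin k => ((p.1 : ℕ), (p.2 : ℕ))).map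
      fun p => .cons (.num p.1) (.num p.2))
    simp only [List.length_map] at h
    refine h.mono ?_
    have := he.length_le_card
    simp only [Fintype.card_prod, Fintype.card_fin] at this
    nlinarith
  have hdels := dels_computes 0 (List.ofFn lam)
  have hcuts := cuts_computes (List.ofFn lam) 0 (adjRows F) (List.ofFn lam)
    (by simp [length_adjRows]) hrows
  have hfind := fun c => find_computes c (List.ofFn lam) 0 (adjRows F) (List.ofFn lam)
    (by simp [length_adjRows]) hrows
  rw [hld] at hdels
  rw [hec] at hcuts
  rw [← encodeGraph_eq] at hcuts
  simp only [← encodeGraph_eq] at hfind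
  simp only [length_adjRows, List.length_ofFn, mul_left_comm (k + 1) 200] at hdels hcuts hfind
  generalize hN : (k + 1) * (k + 1) = N at *
  generalize hDv : nums (l.map (↑)) = D at *
  generalize hCv : pairs (e.map fun p => (↑p.1, ↑p.2)) = C at *
  have hpow : 1 ≤ 3 ^ m := Nat.one_le_pow _ _ (by simp)
  have hbig : 2000 * N ≤ 3 ^ m * ((f + 1) * localCost k) := by
    rw [hq]
    calc 2000 * N = 1 * (1 * (2000 * N)) := by ring
      _ ≤ _ := by gcongr; omega
  -- Here `1000 * N` steps are set aside for listing the deletions, testing the budgets and looking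
  -- for a contact. By `hbig` the truncated subtraction is harmless.
  suffices H : l.length ≤ a → e.length ≤ b → ∃ v, Ev separatorProgram
      [.num (find 2 (List.ofFn lam) 0 (adjRows F) (List.ofFn lam)), C, D,
        .cons (encodeInput F x y a b) (nums (List.ofFn lam))]
      (.ite (.var 0) branchBody extendBody) v
        (3 ^ m * ((f + 1) * localCost k) - 1000 * N) ∧ (v = answerNo ∨ IsAnswer F x y a b v) ∧
      ∀ Good, F.IsSearchInvariant x y a b Good → Good lam → v ≠ answerNo by
    by_cases ha : l.length ≤ a
    · by_cases hb : e.length ≤ b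
      · obtain ⟨v, hv, hv'⟩ := H ha hb
        refine ⟨v, ⟨searchBody, rfl, ?_⟩, hv'⟩
        have hsa : l.length - a = 0 := by omega
        have hsb : e.length - b = 0 := by omega
        exact (Ev.letE (.call (.value rfl) hdels) (.letE (.call (.value rfl) hcuts)
          (.iteFalse (hsa ▸ Ev.sub (.call (.value rfl) hl6) (.value rfl))
            (.iteFalse (hsb ▸ Ev.sub (.call (.value rfl) he6) (.value rfl))
              (.letE (.call (.value rfl) (hfind 2)) hv))))).mono (by simp [Expr.size]; omega)
      · refine ⟨answerNo, ⟨searchBody, rfl, ?_⟩, Or.inl rfl, fun Good hG hg => ?_⟩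
        · have hsa : l.length - a = 0 := by omega
          exact (Ev.letE (.call (.value rfl) hdels) (.letE (.call (.value rfl) hcuts)
            (.iteFalse (hsa ▸ Ev.sub (.call (.value rfl) hl6) (.value rfl))
              (.iteTrue (Ev.sub (.call (.value rfl) he6) (.value rfl)) (by simp; omega)
                (.value rfl))))).mono (by simp [Expr.size]; omega)
        · have := (hG.budget lam hg).2
          omega
    · refine ⟨answerNo, ⟨searchBody, rfl, ?_⟩, Or.inl rfl, fun Good hG hg => ?_⟩
      · exact (Ev.letE (.call (.value rfl) hdels) (.letE (.call (.value rfl) hcuts)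
          (.iteTrue (Ev.sub (.call (.value rfl) hl6) (.value rfl)) (by simp; omega)
            (.value rfl)))).mono (by simp [Expr.size]; omega)
      · have := (hG.budget lam hg).1
        omega
  intro ha hb
  -- Within the budgets at most `a + b` deletions have been made, so a branching is still paid for.
  have hm1 : 1 ≤ m := by omega
  have hpos : ∀ w, lam w = 0 → 0 < f := fun w hw =>
    lt_of_lt_of_le (Finset.card_pos.mpr ⟨w, by simpa using hw⟩) hfree
  by_cases h2 : find 2 (List.ofFn lam) 0 (adjRows F) (List.ofFn lam) = 0
  · have hno2 := not_isContact_of_find h2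
    rw [h2]
    by_cases h1 : find 1 (List.ofFn lam) 0 (adjRows F) (List.ofFn lam) = 0
    · have hno1 := not_isContact_of_find h1
      have hfind1 := hfind 1
      rw [h1] at hfind1
      refine ⟨_, (Ev.iteFalse (.value rfl) (.letE (.call (.value rfl) hfind1)
        (.iteFalse (.value rfl) answerBody_ev))).mono (by simp [Expr.size]; omega), ?_, ?_⟩
      · split
        · rename_i h
          refine Or.inr ⟨labelVertices lam, (F.labelEdges lam).image fun p => s(p.1, p.2),
            ⟨isMixedSeparator_of_labels hle hno1 h.1 h.2.1 h.2.2, by omega,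
              Finset.card_image_le.trans (by omega)⟩, ?_⟩
          rw [← hDv, ← hCv]
          exact representsPair_of_labels hl hl' he he'
        · exact Or.inl rfl
      · intro Good hG hg
        rw [if_pos (hG.answer lam hg hno2 hno1)]
        simp [answerNo]
    · obtain ⟨w, hw, hcw⟩ := exists_isContact_of_find h1
      have hfind1 := hfind 1
      rw [hw] at hfind1
      obtain ⟨f, rfl⟩ : ∃ f', f = f' + 1 := ⟨f - 1, by have := hpos w hcw.1; omega⟩
      obtain ⟨v, hv, hv'⟩ := ih f (Nat.lt_succ_self f) (Function.update lam w 1)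
        (card_free_update hcw.1 (by simp) hfree) (update_le_three (by simp) hle w) m (by
          have h3 := labelVertices_update_le hcw.1 1
          have h4 := Finset.card_le_card (labelEdges_subset_update (F := F) hcw.1 1)
          omega)
      rw [← set_ofFn] at hv
      have hset := set_computes w 1 (List.ofFn lam)
      simp only [List.length_ofFn] at hset
      refine ⟨v, (Ev.iteFalse (.value rfl) (.letE (.call (.value rfl) hfind1)
        (.iteTrue (.value rfl) (by simp) (.call (.cons (.value rfl)
          (.call (.value rfl) hset)) hv)))).mono ?_, hv'.1, fun Good hG hg =>
            hv'.2 Good hG (hG.extend lam w hg hno2 hcw)⟩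
      -- The drop from `f + 2` to `f + 1` releases at least one `localCost`, which covers the work
      -- of this call.
      have hT : 3 ^ m * ((f + 1 + 1) * localCost k) =
          3 ^ m * ((f + 1) * localCost k) + 3 ^ m * localCost k := by ring
      have hle' : localCost k ≤ 3 ^ m * localCost k := Nat.le_mul_of_pos_left _ hpow
      simp [Expr.size]
      omega
  · obtain ⟨w, hw, hcw⟩ := exists_isContact_of_find h2
    rw [hw]
    obtain ⟨f, rfl⟩ : ∃ f', f = f' + 1 := ⟨f - 1, by have := hpos w hcw.1; omega⟩
    obtain ⟨m, rfl⟩ : ∃ m', m = m' + 1 := ⟨m - 1, by omega⟩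
    have hrec : ∀ c, c = 3 ∨ c = 1 ∨ c = 2 → ∃ v, Computes separatorProgram 9
        (.cons (encodeInput F x y a b) (nums ((List.ofFn lam).set w c))) v
          (3 ^ m * ((f + 1) * localCost k)) ∧ (v = answerNo ∨ IsAnswer F x y a b v) ∧
        ∀ Good, F.IsSearchInvariant x y a b Good → Good (Function.update lam w c) →
          v ≠ answerNo := by
      intro c hc
      rw [set_ofFn]
      refine ih f (Nat.lt_succ_self f) (Function.update lam w c)
        (card_free_update hcw.1 (by omega) hfree) (update_le_three (by omega) hle w) m ?_
      have h3 := labelVertices_update_le hcw.1 c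
      have h4 := Finset.card_le_card (labelEdges_subset_update (F := F) hcw.1 c)
      rcases hc with rfl | hc
      · have := labelVertices_update_lt hcw.1
        omega
      · have := labelEdges_update_lt hcw hc
        omega
    obtain ⟨v₃, hv₃, ha₃, hg₃⟩ := hrec 3 (by simp)
    obtain ⟨v₁, hv₁, ha₁, hg₁⟩ := hrec 1 (by simp)
    obtain ⟨v₂, hv₂, ha₂, hg₂⟩ := hrec 2 (by simp)
    obtain ⟨v, hv, hor, hno⟩ := branchBody_ev (C := C) (D := D) hv₃ hv₁ hv₂
    refine ⟨v, (Ev.iteTrue (.value rfl) (by simp) hv).mono ?_, ?_, fun Good hG hg hv0 => ?_⟩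
    · have hT : 3 ^ (m + 1) * ((f + 1 + 1) * localCost k) =
          3 * (3 ^ m * ((f + 1) * localCost k)) + 3 ^ (m + 1) * localCost k := by ring
      have hle' : localCost k ≤ 3 ^ (m + 1) * localCost k := Nat.le_mul_of_pos_left _ hpow
      simp [Expr.size]
      omega
    · rcases hor with rfl | rfl | rfl
      · exact ha₃
      · exact ha₁
      · exact ha₂
    · obtain ⟨h3, h1, h2⟩ := hno hv0
      rcases hG.branch lam w hg hcw with h | h | h
      · exact hg₃ Good hG h h3
      · exact hg₁ Good hG h h1
      · exact hg₂ Good hG h h2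

/-- The cost of one search. -/
def searchCost (k a b : ℕ) : ℕ := 3 ^ (a + b + 1) * ((k + 1) * localCost k)

theorem initLabel_computes (u v : Fin k) :
    nums (((List.replicate k 0).set u 1).set v 2) = nums (List.ofFn (initLabel u v)) := by
  have : List.replicate k 0 = List.ofFn fun _ : Fin k => 0 := by simp
  rw [this, set_ofFn, set_ofFn, initLabel]

theorem localCost_pos (k : ℕ) : 2000 * (k + 1) ≤ localCost k := by
  have := Nat.le_mul_self (k + 1)
  unfold localCost
  omega

theorem localCost_le_searchCost (k a b : ℕ) : localCost k ≤ searchCost k a b := by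
  have hpow : 1 ≤ 3 ^ (a + b + 1) := Nat.one_le_pow _ _ (by simp)
  calc localCost k = 1 * (1 * localCost k) := by ring
    _ ≤ _ := by unfold searchCost; gcongr; omega

/-- Of the two search costs per start, one pays for the search and the other for building the
initial labeling and for the loop. The start with `u` on both sides is harmless, since every answer
is sound. -/
theorem inner_computes (F : SimpleGraph (Fin k)) (x y : Fin k) (a b : ℕ) (u : Fin k) (j : ℕ)
    (hj : j < k) :
    ∃ v, Computes separatorProgram 10 (.cons (encodeInput F x y a b) (.cons (.num u) (.num j))) v
        ((j + 1) * (2 * searchCost k a b)) ∧ (v = answerNo ∨ IsAnswer F x y a b v) ∧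
      ∀ Good, F.IsSearchInvariant x y a b Good → ∀ i : Fin k, i.val ≤ j → Good (initLabel u i) →
        v ≠ answerNo := by
  have hzeros : Computes separatorProgram 7 (encodeGraph F) (nums (List.replicate k 0))
      (10 * (k + 1)) := by
    have h := zeros_computes ((adjRows F).map nums)
    rw [List.length_map, length_adjRows] at h
    rwa [encodeGraph_eq]
  have hset1 := set_computes u 1 (List.replicate k 0)
  have hset2 := fun j => set_computes j 2 ((List.replicate k 0).set u 1)
  simp only [List.length_set, List.length_replicate] at hset1 hset2
  have hcost := localCost_le_searchCost k a b
  have hloc := localCost_pos k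
  have hsearch : ∀ i : Fin k, ∃ v, Computes separatorProgram 9 (.cons (encodeInput F x y a b)
      (nums (((List.replicate k 0).set u 1).set i 2))) v (searchCost k a b) ∧
      (v = answerNo ∨ IsAnswer F x y a b v) ∧
      ∀ Good, F.IsSearchInvariant x y a b Good → Good (initLabel u i) → v ≠ answerNo := by
    intro i
    rw [initLabel_computes]
    exact search_computes F x y a b k (initLabel u i)
      ((Finset.card_le_univ _).trans (by simp)) (fun p => (initLabel_le u i p).trans (by simp))
      (a + b + 1) (by omega)
  induction j with
  | zero =>
    obtain ⟨v, hv, hv', hg⟩ := hsearch ⟨0, hj⟩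
    refine ⟨v, ⟨innerBody, rfl, ?_⟩, hv', fun Good hG i hi h => hg Good hG ?_⟩
    · by_cases h0 : v = .num 0
      · subst h0
        exact (Ev.letE (.call (.cons (.value rfl) (.call (.cons (.value rfl) (.cons (.value rfl)
          (.call (.cons (.value rfl) (.cons (.value rfl) (.call (.value rfl) hzeros))) hset1)))
          (hset2 0))) hv)
          (.iteFalse (.value rfl) (.iteFalse (.value rfl) (.value rfl)))).mono
          (by simp [Expr.size]; omega)
      · exact (Ev.letE (.call (.cons (.value rfl) (.call (.cons (.value rfl) (.cons (.value rfl)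
          (.call (.cons (.value rfl) (.cons (.value rfl) (.call (.value rfl) hzeros))) hset1)))
          (hset2 0))) hv)
          (.iteTrue (.value rfl) h0 (.value rfl))).mono (by simp [Expr.size]; omega)
    · obtain rfl : i = ⟨0, hj⟩ := Fin.ext (by simpa using hi)
      exact h
  | succ j ih =>
    obtain ⟨v, hv, hv', hg⟩ := hsearch ⟨j + 1, hj⟩
    obtain ⟨w, hw, hw', hgw⟩ := ih (by omega)
    rw [add_mul (j + 1) 1, one_mul]
    generalize hT : (j + 1) * (2 * searchCost k a b) = T at hw ⊢
    by_cases h0 : v = .num 0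
    · subst h0
      refine ⟨w, ⟨innerBody, rfl, ?_⟩, hw', fun Good hG i hi h => ?_⟩
      · exact (Ev.letE (.call (.cons (.value rfl) (.call (.cons (.value rfl) (.cons (.value rfl)
          (.call (.cons (.value rfl) (.cons (.value rfl) (.call (.value rfl) hzeros))) hset1)))
          (hset2 (j + 1)))) hv)
          (.iteFalse (.value rfl) (.iteTrue (u := .num (j + 1)) (.value rfl) (by simp)
            (.call (.value rfl) hw)))).mono
          (by simp [Expr.size]; omega)
      · rcases Nat.lt_or_ge j i.val with hlt | hge
        · obtain rfl : i = ⟨j + 1, hj⟩ := Fin.ext (by simp; omega)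
          exact absurd rfl (hg Good hG h)
        · exact hgw Good hG i hge h
    · refine ⟨v, ⟨innerBody, rfl, ?_⟩, hv', fun _ _ _ _ _ => h0⟩
      exact (Ev.letE (.call (.cons (.value rfl) (.call (.cons (.value rfl) (.cons (.value rfl)
          (.call (.cons (.value rfl) (.cons (.value rfl) (.call (.value rfl) hzeros))) hset1)))
          (hset2 (j + 1)))) hv)
          (.iteTrue (.value rfl) h0 (.value rfl))).mono (by simp [Expr.size]; omega)

theorem length_encodeGraph_computes (F : SimpleGraph (Fin k)) :
    Computes separatorProgram 6 (encodeGraph F) (.num k) (10 * (k + 1)) := by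
  have h := length_computes ((adjRows F).map nums)
  rw [List.length_map, length_adjRows] at h
  rwa [encodeGraph_eq]

theorem outer_computes (F : SimpleGraph (Fin k)) (x y : Fin k) (a b : ℕ) (j : ℕ) (hj : j < k) :
    ∃ v, Computes separatorProgram 11 (.cons (encodeInput F x y a b) (.num j)) v
        ((j + 1) * (k * (2 * searchCost k a b) + searchCost k a b)) ∧
      (v = answerNo ∨ IsAnswer F x y a b v) ∧
      ∀ Good, F.IsSearchInvariant x y a b Good → ∀ u i : Fin k, u.val ≤ j →
        Good (initLabel u i) → v ≠ answerNo := by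
  have hlen := length_encodeGraph_computes F
  have hcost := localCost_le_searchCost k a b
  have hloc := localCost_pos k
  have hinner : ∀ u : Fin k, ∃ v, Computes separatorProgram 10 (.cons (encodeInput F x y a b)
      (.cons (.num u) (.num (k - 1)))) v (k * (2 * searchCost k a b)) ∧
      (v = answerNo ∨ IsAnswer F x y a b v) ∧
      ∀ Good, F.IsSearchInvariant x y a b Good → ∀ i : Fin k, Good (initLabel u i) →
        v ≠ answerNo := by
    intro u
    obtain ⟨v, hv, hv', hg⟩ := inner_computes F x y a b u (k - 1) (by omega)
    rw [Nat.sub_add_cancel (by omega)] at hv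
    exact ⟨v, hv, hv', fun Good hG i => hg Good hG i (by omega)⟩
  generalize k * (2 * searchCost k a b) = T at hinner ⊢
  induction j with
  | zero =>
    obtain ⟨v, hv, hv', hg⟩ := hinner ⟨0, hj⟩
    refine ⟨v, ⟨outerBody, rfl, ?_⟩, hv', fun Good hG u i hu h => hg Good hG i ?_⟩
    · by_cases h0 : v = .num 0
      · subst h0
        exact (Ev.letE (.call (.cons (.value rfl) (.cons (.value rfl)
          (.sub (.call (.value rfl) hlen) (.value rfl)))) hv)
          (.iteFalse (.value rfl) (.iteFalse (.value rfl) (.value rfl)))).mono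
          (by simp [Expr.size]; omega)
      · exact (Ev.letE (.call (.cons (.value rfl) (.cons (.value rfl)
          (.sub (.call (.value rfl) hlen) (.value rfl)))) hv)
          (.iteTrue (.value rfl) h0 (.value rfl))).mono (by simp [Expr.size]; omega)
    · obtain rfl : u = ⟨0, hj⟩ := Fin.ext (by simpa using hu)
      exact h
  | succ j ih =>
    obtain ⟨v, hv, hv', hg⟩ := hinner ⟨j + 1, hj⟩
    obtain ⟨w, hw, hw', hgw⟩ := ih (by omega)
    rw [add_mul (j + 1) 1, one_mul]
    generalize hT : (j + 1) * (T + searchCost k a b) = T' at hw ⊢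
    by_cases h0 : v = .num 0
    · subst h0
      refine ⟨w, ⟨outerBody, rfl, ?_⟩, hw', fun Good hG u i hu h => ?_⟩
      · exact (Ev.letE (.call (.cons (.value rfl) (.cons (.value rfl)
          (.sub (.call (.value rfl) hlen) (.value rfl)))) hv)
          (.iteFalse (.value rfl) (.iteTrue (u := .num (j + 1)) (.value rfl) (by simp)
            (.call (.value rfl) hw)))).mono (by simp [Expr.size]; omega)
      · rcases Nat.lt_or_ge j u.val with hlt | hge
        · obtain rfl : u = ⟨j + 1, hj⟩ := Fin.ext (by simp; omega)
          exact absurd rfl (hg Good hG i h)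
        · exact hgw Good hG u i hge h
    · refine ⟨v, ⟨outerBody, rfl, ?_⟩, hv', fun _ _ _ _ _ _ => h0⟩
      exact (Ev.letE (.call (.cons (.value rfl) (.cons (.value rfl)
          (.sub (.call (.value rfl) hlen) (.value rfl)))) hv)
          (.iteTrue (.value rfl) h0 (.value rfl))).mono (by simp [Expr.size]; omega)

end Search

end Lisp

/-! ### The final running time -/

theorem lemma4 :
    ∃ (P : Lisp.Program) (c : ℕ),
      ∀ (n : ℕ) (F : SimpleGraph (Fin n)), F.IsChordalGraph →
      ∀ (x y : Fin n), x ≠ y → ¬ F.Adj x y →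
      ∀ (a b : ℕ),
        ∃ (v : Lisp.Val) (t : ℕ),
          P.Runs (Lisp.encodeInput F x y a b) v t ∧
          t ≤ 3 ^ (a + b + 1) * n ^ c ∧
          ((∃ (VS : Finset (Fin n)) (ES : Finset (Sym2 (Fin n))),
              F.IsMixedSeparatorOfSizeAtMost x y a b VS ES ∧ Lisp.RepresentsPair v VS ES) ∨
            (v = Lisp.answerNo ∧
              ¬ ∃ (VS : Finset (Fin n)) (ES : Finset (Sym2 (Fin n))),
                F.IsMixedSeparatorOfSizeAtMost x y a b VS ES)) := by
  refine ⟨Lisp.separatorProgram, 21, fun n F hF x y hxy _ a b => ?_⟩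
  -- This lets powers of `n` absorb all constants: `2000 ≤ 2 ^ 11`, and with `4` for the loops over
  -- pairs and `2` for each of three factors `n + 1` the exponent is `4 + 2 + 11 + 4 = 21`.
  have hn : 2 ≤ n := by
    have hx := x.2
    have hy := y.2
    have : x.val ≠ y.val := fun h => hxy (Fin.ext h)
    omega
  obtain ⟨v, hv, hans, hg⟩ := Lisp.outer_computes F x y a b (n - 1) (by omega)
  rw [Nat.sub_add_cancel (by omega)] at hv
  have hcost := Lisp.localCost_le_searchCost n a b
  have hloc := Lisp.localCost_pos n
  obtain ⟨t, ht, hrun⟩ : Lisp.Ev Lisp.separatorProgram [Lisp.encodeInput F x y a b]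
      Lisp.separatorProgram.main v
      (n * (n * (2 * Lisp.searchCost n a b) + Lisp.searchCost n a b) +
        Lisp.searchCost n a b) :=
    (Lisp.Ev.call (.cons (.value rfl) (.sub (.call (.value rfl)
      (Lisp.length_encodeGraph_computes F)) (.value rfl))) hv).mono
      (by simp [Lisp.Expr.size]; omega)
  refine ⟨v, t, hrun, ht.trans ?_, ?_⟩
  · have h1 : n + 1 ≤ n ^ 2 := by nlinarith
    have h2 : 2000 ≤ n ^ 11 := le_trans (by norm_num) (Nat.pow_le_pow_left hn 11)
    have h3 : n * (n * 2 + 1) + 1 ≤ n ^ 4 := by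
      have h4 : 4 ≤ n ^ 2 := by nlinarith
      nlinarith
    calc n * (n * (2 * Lisp.searchCost n a b) + Lisp.searchCost n a b) + Lisp.searchCost n a b
        = 3 ^ (a + b + 1) * ((n * (n * 2 + 1) + 1) * ((n + 1) * (2000 * ((n + 1) * (n + 1))))) := by
          unfold Lisp.searchCost Lisp.localCost
          ring
      _ ≤ 3 ^ (a + b + 1) * (n ^ 4 * (n ^ 2 * (n ^ 11 * (n ^ 2 * n ^ 2)))) := by gcongr
      _ = 3 ^ (a + b + 1) * n ^ 21 := by ring
  · by_cases hex : ∃ (VS : Finset (Fin n)) (ES : Finset (Sym2 (Fin n))),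
        F.IsMixedSeparatorOfSizeAtMost x y a b VS ES
    · obtain ⟨Good, hG, u, w, huw⟩ := SimpleGraph.exists_isSearchInvariant hF hex
      exact Or.inl (hans.resolve_left (hg Good hG u w (by omega) huw))
    · rcases hans with h | ⟨VS, ES, h, -⟩
      · exact Or.inr ⟨h, hex⟩
      · exact absurd ⟨VS, ES, h⟩ hex
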